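/- **The algorithm.** Accelerated Orthogonal Least-Squares (AOLS) has as input a matrix $\mathbf A\in\mathbb R^{n\times m}$ with columns $\mathbf a_1,\dots,\mathbf a_m$, a vector $\mathbf y\in\mathbb R^n$, a sparsity level $k$, a number $L$ with $1\le L\le\lfloor n/k\rfloor$, and a threshold $\epsilon\ge 0$. It starts with $i=0$, $\mathcal S=\emptyset$, $\mathbf r=\mathbf y$, $\mathbf t_j=\mathbf a_j$, and writes $\mathbf q_j=\frac{\mathbf a_j^\top\mathbf r}{\mathbf a_j^\top\mathbf t_j}\mathbf t_j$ throughout (for the current $\mathbf r$ and $\mathbf t_j$). While $\|\mathbf r\|_2\ge\epsilon$ and $i<k$, it selects $L$ indices $j\notin\mathcal S$ with the $L$ largest values of $\|\mathbf q_j\|_2$ (ties are broken arbitrarily), increases $i$ by one, and for each selected index $s$ in turn puts $\mathbf u=\mathbf q_s$ and replaces $\mathcal S$ by $\mathcal S\cup\{s\}$, $\mathbf r$ by $\mathbf r-\mathbf u$, and every $\mathbf t_j$ by $\mathbf t_j-\frac{\mathbf t_j^\top\mathbf u}{\|\mathbf u\|_2^2}\mathbf u$. AOLS *recovers* $\mathbf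 x\in\mathbb R^m$ in at most $k$ iterations if the final set $\mathcal S$ contains every $j$ with $\mathbf x_j\neq 0$, however ties are broken. **Statement.** For every integer $L\ge1$ and every real $C_4>1$ there are positive constants $C_1,C_2,C_3,C_5$, depending only on $L$ and $C_4$, such that the following holds. Let $0<\beta<1$, let $1\le k<n<m$ be integers with $L\le\lfloor n/k\rfloor$ and $m>(k+L-1)^{3/2}$, and assume $$n\ \ge\ \max\left\{\frac{6}{C_1}\,k\log\frac{m}{(k+L-1)\sqrt[3]{\beta}},\ \frac{C_2k+\log\frac{8}{\beta^2}}{C_3}\right\}.$$ Let $\mathbf x\in\mathbb R^m$ be any vector with at most $k$ nonzero entries, let $\mathbf A\in\mathbb R^{n\times m}$ be a random matrix with independent entries of law $\mathcal N(0,1/n)$, let $\boldsymbol\nu\in\mathbb R^n$ be a random vector, independent of $\mathbf A$, with independent entries of law $\mathcal N(0,\sigma^2)$, where $\sigma\ge0$, and let $\mathbf y=\mathbf A\mathbf x+\boldsymbol\nu$. Let the threshold satisfy $0\le\epsilon\le C_5\min_{\mathbf x_j\ne0}|\mathbf x_j|$ (no upper bound if $\mathbf x=\mathbf 0$). Then,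 conditionally on the event that $\min_{\mathbf x_j\neq0}|\mathbf x_j|\ge C_4\|\boldsymbol\nu\|_2$, AOLS with input $\mathbf y,\mathbf A,k,L,\epsilon$ recovers $\mathbf x$ in at most $k$ iterations with probability greater than $1-\beta^2$. -/

import Mathlib

open MeasureTheory ProbabilityTheory
open scoped NNReal Matrix

noncomputable section

namespace AOLS

/-- The `j`-th column of `A`, as a vector of Euclidean space. -/
def col {n m : ℕ} (A : Matrix (Fin n) (Fin m) ℝ) (j : Fin m) : EuclideanSpace ℝ (Fin n) :=
  WithLp.toLp 2 fun i => A i j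

/-- The noisy measurements `y = A x + ν`. -/
def measurements {n m : ℕ} (A : Matrix (Fin n) (Fin m) ℝ) (x : Fin m → ℝ)
    (ν : EuclideanSpace ℝ (Fin n)) : EuclideanSpace ℝ (Fin n) :=
  WithLp.toLp 2 (A *ᵥ x) + ν

/-- The variables of the algorithm: the set `S` of selected indices, the residual `r`, and the
vectors `t j`. -/
structure State (n m : ℕ) where
  S : Finset (Fin m)
  r : EuclideanSpace ℝ (Fin n)
  t : Fin m → EuclideanSpace ℝ (Fin n)

/-- Initialization: nothing is selected, the residual is `y`, and `t j` is the `j`-th column. -/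
def init {n m : ℕ} (A : Matrix (Fin n) (Fin m) ℝ) (y : EuclideanSpace ℝ (Fin n)) : State n m where
  S := ∅
  r := y
  t := col A

/-- The vector `q_j = (a_jᵀ r / a_jᵀ t_j) t_j`. -/
def q {n m : ℕ} (A : Matrix (Fin n) (Fin m) ℝ) (st : State n m) (j : Fin m) :
    EuclideanSpace ℝ (Fin n) :=
  (inner ℝ (col A j) st.r / inner ℝ (col A j) (st.t j)) • st.t j

/-- One application of the recursion, for the selected index `s`: with `u = q_s`, the residual
becomes `r - u` and every `t_j` becomes `t_j - (t_jᵀ u / ‖u‖²) u`. -/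
def addColumn {n m : ℕ} (A : Matrix (Fin n) (Fin m) ℝ) (st : State n m) (s : Fin m) :
    State n m where
  S := insert s st.S
  r := st.r - q A st s
  t := fun j => st.t j - (inner ℝ (st.t j) (q A st s) / ‖q A st s‖ ^ 2) • q A st s

/-- `sel` lists, without repetition, `L` not yet selected indices that correspond to the `L`
largest of the norms `‖q_j‖` over all not yet selected `j` (ties are broken in any way). -/
def IsSelection {n m : ℕ} (A : Matrix (Fin n) (Fin m) ℝ) (L : ℕ) (st : State n m)
    (sel : List (Fin m)) : Prop :=
  sel.Nodup ∧ sel.length = L ∧ (∀ j ∈ sel, j ∉ st.S) ∧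
    ∀ j ∈ sel, ∀ l, l ∉ st.S → l ∉ sel → ‖q A st l‖ ≤ ‖q A st j‖

/-- The guard of the main loop, after `i` iterations. -/
def Continues {n m : ℕ} (k : ℕ) (ε : ℝ) (i : ℕ) (st : State n m) : Prop :=
  ε ≤ ‖st.r‖ ∧ i < k

/-- `Reaches A y k L ε i st`: on input `y`, `A`, `k`, `ε`, `L`, the main loop can be in the state
`st` after `i` iterations. An iteration selects `L` indices and then applies the recursion once
for each of them. -/
inductive Reaches {n m : ℕ} (A : Matrix (Fin n) (Fin m) ℝ) (y : EuclideanSpace ℝ (Fin n))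
    (k L : ℕ) (ε : ℝ) : ℕ → State n m → Prop
  | start : Reaches A y k L ε 0 (init A y)
  | iterate {i : ℕ} {st : State n m} {sel : List (Fin m)} :
      Reaches A y k L ε i st → Continues k ε i st → IsSelection A L st sel →
      Reaches A y k L ε (i + 1) (sel.foldl (addColumn A) st)

/-- `S` is a set of indices with which the algorithm can end. -/
def IsOutput {n m : ℕ} (A : Matrix (Fin n) (Fin m) ℝ) (y : EuclideanSpace ℝ (Fin n))
    (k L : ℕ) (ε : ℝ) (S : Finset (Fin m)) : Prop :=
  ∃ (i : ℕ) (st : State n m), Reaches A y k L ε i st ∧ ¬ Continues k ε i st ∧ st.S = S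

/-- The algorithm recovers `x` (in at most `k` iterations, by the guard of the loop): it comes to
an end, and however ties are broken, the selected set contains all indices of nonzero entries
of `x`. -/
def Recovers {n m : ℕ} (A : Matrix (Fin n) (Fin m) ℝ) (y : EuclideanSpace ℝ (Fin n))
    (k L : ℕ) (ε : ℝ) (x : Fin m → ℝ) : Prop :=
  (∃ S, IsOutput A y k L ε S) ∧ ∀ S, IsOutput A y k L ε S → ∀ j, x j ≠ 0 → j ∈ S

/-- The entries of the random matrix `A` are independent, with law `N(0, 1/n)`. -/
def IsGaussianMatrix {n m : ℕ} {Ω : Type*} [MeasurableSpace Ω] (μ : Measure Ω)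
    (A : Ω → Matrix (Fin n) (Fin m) ℝ) : Prop :=
  (∀ i j, HasLaw (fun ω => A ω i j) (gaussianReal 0 (1 / (n : ℝ≥0))) μ) ∧
    iIndepFun (fun (p : Fin n × Fin m) ω => A ω p.1 p.2) μ

/-- The entries of the random vector `ν` are independent, with law `N(0, σ²)`. -/
def IsGaussianNoise {n : ℕ} {Ω : Type*} [MeasurableSpace Ω] (μ : Measure Ω) (σ : ℝ≥0)
    (ν : Ω → EuclideanSpace ℝ (Fin n)) : Prop :=
  (∀ i, HasLaw (fun ω => ν ω i) (gaussianReal 0 (σ ^ 2)) μ) ∧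
    iIndepFun (fun (i : Fin n) ω => ν ω i) μ

end AOLS

end

/-!
Let `T` be the support of `x`. After the indices in `S` have been selected, the residual is
`r = P (A x + ν)`, where `P = res (col A) S` projects onto the orthogonal complement of the selected
columns, and `‖q_j‖ = |⟪a_j, r⟫| / ‖P a_j‖` (`Matches.norm_q`). The algorithm recovers `x` if every
iteration selects an index of `T` as long as some index of `T` is missing.

*Columns of the support.* Let `z` be the part of `A x` that comes from the missing indices. It is
independent of the selected columns, so `‖P z‖` is hardly less than the norm of that part of `x`
(`matLaw_norm_res_lt`), uniformly over all sets `S` of at most `k L` indices because `n` is much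
larger than `k log m`. Since `C₄ > 1`, the noise is smaller than `‖P z‖` by a constant factor. As
`⟪z, r⟫` is a combination of at most `k` inner products `⟪a_j, r⟫`, one of these is at least a
constant times `‖r‖ / √k` (`le_sqrt_mul_of_forall_abs_inner_le`).

*Columns outside of the support.* The residual depends on the selected columns, some of which are
not in the support, and there are too many possible sets `S` for a union bound at the scale
`‖r‖ / √k`. Instead one leaves out one column: as long as `j` has not been selected, the algorithm
has run as if the column `j` did not exist (`Run.erase`). If `x j = 0`, the residual of that run is
independent of `a_j`, so `|⟪a_j, r⟫|` is at most a small constant times `‖r‖ / √k` except with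
probability `2 exp (-c n / k)` (`matLaw_incoherent`), and a union bound over the `m` indices and the
`k` iterations is enough. Hence no column outside of the support beats all missing columns of the
support. This needs that the run is determined by the columns, that is, that there are almost surely
no ties; it also needs that no `q_s` vanishes when the recursion is applied, for otherwise the
recursion would not compute projections. Both follow from `ae_generic`: ties and orthogonalities
are zeros of polynomials that do not vanish identically on lines.

Everything is done for a fixed value of the noise, so that conditioning on an event that only
depends on the noise does no harm (`one_sub_le_cond_real`).
-/

namespace AOLS

open scoped RealInnerProductSpace

/-! ### Orthogonal residuals and runs of the greedy selection -/

section Residual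

variable {E : Type*} [NormedAddCommGroup E] [InnerProductSpace ℝ E] [FiniteDimensional ℝ E]
  {ι : Type*}

/-- The orthogonal projection onto the orthogonal complement of the span of the vectors `c j`
with `j ∈ S`. -/
noncomputable def res (c : ι → E) (S : Finset ι) : E →L[ℝ] E :=
  (Submodule.span ℝ (c '' S))ᗮ.starProjection

lemma res_mem (c : ι → E) (S : Finset ι) (z : E) : res c S z ∈ (Submodule.span ℝ (c '' S))ᗮ :=
  Submodule.starProjection_apply_mem _ _

lemma res_eq_self {c : ι → E} {S : Finset ι} {z : E} (hz : z ∈ (Submodule.span ℝ (c '' S))ᗮ) :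
    res c S z = z :=
  Submodule.starProjection_eq_self_iff.2 hz

lemma res_res (c : ι → E) (S : Finset ι) (z : E) : res c S (res c S z) = res c S z :=
  res_eq_self (res_mem c S z)

lemma inner_res_left (c : ι → E) (S : Finset ι) (z w : E) : ⟪res c S z, w⟫ = ⟪z, res c S w⟫ :=
  Submodule.inner_starProjection_left_eq_right _ _ _

lemma inner_res_res (c : ι → E) (S : Finset ι) (z w : E) :
    ⟪res c S z, res c S w⟫ = ⟪z, res c S w⟫ := by
  rw [inner_res_left, res_res]

lemma norm_res_le (c : ι → E) (S : Finset ι) (z : E) : ‖res c S z‖ ≤ ‖z‖ :=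
  Submodule.norm_starProjection_apply_le _ _

@[simp] lemma res_empty (c : ι → E) (z : E) : res c ∅ z = z :=
  res_eq_self (by simp)

lemma res_apply_of_mem {c : ι → E} {S : Finset ι} {j : ι} (hj : j ∈ S) : res c S (c j) = 0 := by
  refine (Submodule.starProjection_apply_eq_zero_iff _).2 ?_
  exact Submodule.le_orthogonal_orthogonal _ (Submodule.subset_span ⟨j, hj, rfl⟩)

lemma res_congr {c c' : ι → E} {S : Finset ι} (h : ∀ j ∈ S, c j = c' j) : res c S = res c' S := by
  have : c '' S = c' '' S := Set.image_congr h
  simp only [res, this]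

/-- One step of the Gram–Schmidt process. The junk value of the division by zero gives the right
answer if `c s` lies in the span. -/
lemma res_insert [DecidableEq ι] (c : ι → E) (S : Finset ι) (s : ι) (z : E) :
    res c (insert s S) z =
      res c S z - (⟪res c S (c s), res c S z⟫ / ‖res c S (c s)‖ ^ 2) • res c S (c s) := by
  set p := res c S (c s) with hp
  set V := Submodule.span ℝ (c '' S) with hV
  have hle : c '' S ⊆ c '' (insert s S : Finset ι) := by
    apply Set.image_mono; simp
  have hVW : V ≤ Submodule.span ℝ (c '' (insert s S : Finset ι)) := Submodule.span_mono hle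
  have hpc : c s - p ∈ V := by
    have : c s - p = V.starProjection (c s) := by
      rw [hp, res, Submodule.starProjection_orthogonal_val]; abel
    rw [this]; exact Submodule.starProjection_apply_mem _ _
  have hpW : p ∈ Submodule.span ℝ (c '' (insert s S : Finset ι)) := by
    have h1 : c s ∈ Submodule.span ℝ (c '' (insert s S : Finset ι)) :=
      Submodule.subset_span ⟨s, by simp, rfl⟩
    have := Submodule.sub_mem _ h1 (hVW hpc)
    simpa using this
  rw [res]
  refine Submodule.eq_starProjection_of_mem_orthogonal ?_ ?_
  · rw [Submodule.mem_orthogonal]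
    intro u hu
    induction hu using Submodule.span_induction with
    | mem u hu =>
      obtain ⟨j, hj, rfl⟩ := hu
      simp only [Finset.coe_insert, Set.mem_insert_iff, Finset.mem_coe] at hj
      rcases hj with rfl | hj
      · rw [inner_sub_right, inner_smul_right]
        have e1 : ⟪c j, res c S z⟫ = ⟪p, res c S z⟫ := by rw [hp, inner_res_res]
        have e2 : ⟪c j, p⟫ = ‖p‖ ^ 2 := by
          rw [← real_inner_self_eq_norm_sq, hp, inner_res_res]
        rw [e1, e2]
        by_cases h0 : p = 0
        · simp [h0]
        · have : ‖p‖ ^ 2 ≠ 0 := by positivity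
          field_simp
          ring
      · rw [inner_sub_right, inner_smul_right, ← inner_res_left c S (c j) z, hp,
          ← inner_res_left c S (c j) (c s), res_apply_of_mem hj]
        simp
    | zero => simp
    | add u v _ _ hu hv => rw [inner_add_left, hu, hv, add_zero]
    | smul a u _ hu => rw [real_inner_smul_left, hu, mul_zero]
  · refine Submodule.le_orthogonal_orthogonal _ ?_
    have h1 : z - res c S z ∈ V := by
      have : z - res c S z = V.starProjection z := by
        rw [res, Submodule.starProjection_orthogonal_val]; abel
      rw [this]; exact Submodule.starProjection_apply_mem _ _
    have : z - (res c S z - (⟪p, res c S z⟫ / ‖p‖ ^ 2) • p) =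
      (z - res c S z) + (⟪p, res c S z⟫ / ‖p‖ ^ 2) • p := by abel
    rw [this]
    exact Submodule.add_mem _ (hVW h1) (Submodule.smul_mem _ _ hpW)

/-- The norm of `q_j` when the set of selected indices is `S`. -/
noncomputable def score (c : ι → E) (y : E) (S : Finset ι) (j : ι) : ℝ :=
  |⟪c j, res c S y⟫| / ‖res c S (c j)‖

lemma score_congr {c c' : ι → E} (y : E) {S : Finset ι} {j : ι} (h : ∀ l ∈ S, c l = c' l)
    (hj : c j = c' j) : score c y S j = score c' y S j := by
  rw [score, score, res_congr h, hj]

variable [DecidableEq ι]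

/-- `S'` arises from `S` by adding `L` indices from `J` with the largest scores. -/
def IsTop (c : ι → E) (y : E) (L : ℕ) (J S S' : Finset ι) : Prop :=
  S ⊆ S' ∧ S' ⊆ S ∪ J ∧ S'.card = S.card + L ∧
    ∀ a ∈ S' \ S, ∀ b ∈ J \ S', score c y S b ≤ score c y S a

/-- After `i` iterations of the greedy selection in which only the indices in `J` compete, the set
of selected indices can be `S`. The residual has to be nonzero before each iteration. -/
def Run (c : ι → E) (y : E) (L : ℕ) (J : Finset ι) : ℕ → Finset ι → Prop
  | 0, S => S = ∅
  | i + 1, S' => ∃ S, Run c y L J i S ∧ res c S y ≠ 0 ∧ IsTop c y L J S S'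

lemma Run.card {c : ι → E} {y : E} {L : ℕ} {J : Finset ι} :
    ∀ {i : ℕ} {S : Finset ι}, Run c y L J i S → S.card = i * L
  | 0, S, h => by simp [show S = ∅ from h]
  | i + 1, S', ⟨S, h, _, ht⟩ => by rw [ht.2.2.1, h.card]; ring

lemma Run.subset {c : ι → E} {y : E} {L : ℕ} {J : Finset ι} :
    ∀ {i : ℕ} {S : Finset ι}, Run c y L J i S → S ⊆ J
  | 0, S, h => by simp [show S = ∅ from h]
  | i + 1, S', ⟨S, h, _, ht⟩ =>
    ht.2.1.trans (Finset.union_subset h.subset subset_rfl)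

/-- As long as `j` has not been selected, a run coincides with a run in which `j` does not
compete. -/
lemma Run.erase {c : ι → E} {y : E} {L : ℕ} {J : Finset ι} {j : ι} :
    ∀ {i : ℕ} {S : Finset ι}, Run c y L J i S → j ∉ S → Run c y L (J.erase j) i S
  | 0, S, h, _ => h
  | i + 1, S', ⟨S, h, h0, h1, h2, h3, h4⟩, hj => by
    refine ⟨S, h.erase fun hS => hj (h1 hS), h0, h1, fun a ha => ?_, h3, fun a ha b hb => ?_⟩
    · have := h2 ha
      have haj : a ≠ j := fun e => hj (e ▸ ha)
      simp only [Finset.mem_union, Finset.mem_erase] at this ⊢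
      tauto
    · refine h4 a ha b ?_
      simp only [Finset.mem_sdiff, Finset.mem_erase] at hb ⊢
      tauto

lemma Run.congr {c c' : ι → E} {y : E} {L : ℕ} {J : Finset ι} (hc : ∀ j ∈ J, c j = c' j) :
    ∀ {i : ℕ} {S : Finset ι}, Run c y L J i S → Run c' y L J i S
  | 0, S, h => h
  | i + 1, S', ⟨S, h, h0, h1, h2, h3, h4⟩ => by
    have hS : ∀ j ∈ S, c j = c' j := fun j hj => hc j (h.subset hj)
    refine ⟨S, h.congr hc, by rwa [← res_congr hS], h1, h2, h3, fun a ha b hb => ?_⟩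
    have hb' : b ∈ J := (Finset.mem_sdiff.1 hb).1
    have ha' : a ∈ J := by
      obtain ⟨ha1, ha2⟩ := Finset.mem_sdiff.1 ha
      exact (Finset.mem_union.1 (h2 ha1)).resolve_left ha2
    rw [← score_congr y hS (hc a ha'), ← score_congr y hS (hc b hb')]
    exact h4 a ha b hb

/-- General position: as long as at most `N` indices have been selected and the residual is
nonzero, the remaining columns are outside the span of the selected ones, not orthogonal to the
residual, and their scores are distinct. -/
def Generic (c : ι → E) (y : E) (N : ℕ) : Prop :=
  ∀ S : Finset ι, S.card ≤ N → ∀ a, a ∉ S → res c S (c a) ≠ 0 ∧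
    (res c S y ≠ 0 → ⟪c a, res c S y⟫ ≠ 0 ∧
      ∀ b, b ∉ S → b ≠ a → score c y S a ≠ score c y S b)

lemma IsTop.unique {c : ι → E} {y : E} {L N : ℕ} {J S S₁ S₂ : Finset ι} (hg : Generic c y N)
    (hS : S.card ≤ N) (h0 : res c S y ≠ 0) (h₁ : IsTop c y L J S S₁) (h₂ : IsTop c y L J S S₂) :
    S₁ = S₂ := by
  by_contra hne
  obtain ⟨a, ha1, ha2⟩ : ∃ a ∈ S₁, a ∉ S₂ := by
    by_contra! h
    exact hne (Finset.eq_of_subset_of_card_le h (by rw [h₁.2.2.1, h₂.2.2.1]))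
  obtain ⟨b, hb1, hb2⟩ : ∃ b ∈ S₂, b ∉ S₁ := by
    by_contra! h
    exact hne (Finset.eq_of_subset_of_card_le h (by rw [h₁.2.2.1, h₂.2.2.1])).symm
  have haS : a ∉ S := fun h => ha2 (h₂.1 h)
  have hbS : b ∉ S := fun h => hb2 (h₁.1 h)
  have haJ : a ∈ J := (Finset.mem_union.1 (h₁.2.1 ha1)).resolve_left haS
  have hbJ : b ∈ J := (Finset.mem_union.1 (h₂.2.1 hb1)).resolve_left hbS
  have e1 := h₁.2.2.2 a (by simp [*]) b (by simp [*])
  have e2 := h₂.2.2.2 b (by simp [*]) a (by simp [*])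
  refine ((hg S hS a haS).2 h0).2 b hbS ?_ (le_antisymm e2 e1)
  rintro rfl; exact ha2 hb1

/-- Without ties there is at most one run. The last of the `i` selections is made when `(i - 1) * L`
indices have been selected. -/
lemma Run.unique {c : ι → E} {y : E} {L N : ℕ} {J : Finset ι} (hg : Generic c y N) :
    ∀ {i : ℕ} {S₁ S₂ : Finset ι}, (i - 1) * L ≤ N → Run c y L J i S₁ → Run c y L J i S₂ → S₁ = S₂
  | 0, S₁, S₂, _, h₁, h₂ => by
    rw [show S₁ = ∅ from h₁, show S₂ = ∅ from h₂]
  | i + 1, S₁, S₂, hi, ⟨R₁, h₁, h0, ht₁⟩, ⟨R₂, h₂, _, ht₂⟩ => by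
    have hi' : i * L ≤ N := by simpa using hi
    obtain rfl := h₁.unique hg ((Nat.mul_le_mul_right L (Nat.sub_le i 1)).trans hi') h₂
    exact ht₁.unique hg (by rwa [h₁.card]) h0 ht₂

end Residual

/-! ### Deterministic recovery -/

section Deterministic

variable {n m : ℕ}

lemma measurements_eq (A : Matrix (Fin n) (Fin m) ℝ) (x : Fin m → ℝ)
    (ν : EuclideanSpace ℝ (Fin n)) :
    measurements A x ν = ∑ j, x j • col A j + ν := by
  ext i
  simp [measurements, col, Matrix.mulVec, dotProduct, mul_comm]

/-- The state in which the residual and the vectors `t j` are the projections of `y` and of the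
columns onto the orthogonal complement of the span of the selected columns. -/
structure Matches (A : Matrix (Fin n) (Fin m) ℝ) (y : EuclideanSpace ℝ (Fin n))
    (st : State n m) : Prop where
  r_eq : st.r = res (col A) st.S y
  t_eq : ∀ j, st.t j = res (col A) st.S (col A j)

variable {A : Matrix (Fin n) (Fin m) ℝ} {y : EuclideanSpace ℝ (Fin n)} {st : State n m}

lemma matches_init : Matches A y (init A y) where
  r_eq := by simp [init]
  t_eq := by simp [init]

lemma Matches.q_eq (h : Matches A y st) (j : Fin m) :
    q A st j = (⟪col A j, res (col A) st.S y⟫ / ‖res (col A) st.S (col A j)‖ ^ 2) •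
      res (col A) st.S (col A j) := by
  rw [q, h.r_eq, h.t_eq, ← real_inner_self_eq_norm_sq, inner_res_res]

lemma Matches.norm_q (h : Matches A y st) (j : Fin m) :
    ‖q A st j‖ = score (col A) y st.S j := by
  rw [h.q_eq, norm_smul, norm_div, score, Real.norm_eq_abs, norm_pow, norm_norm]
  by_cases h0 : ‖res (col A) st.S (col A j)‖ = 0
  · simp [h0]
  · field_simp

lemma Matches.addColumn (h : Matches A y st) {s : Fin m}
    (hs : res (col A) st.S (col A s) ≠ 0) (hy : ⟪col A s, res (col A) st.S y⟫ ≠ 0) :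
    Matches A y (addColumn A st s) := by
  have hp : ‖res (col A) st.S (col A s)‖ ≠ 0 := norm_ne_zero_iff.2 hs
  refine ⟨?_, fun j => ?_⟩
  · simp only [AOLS.addColumn]
    rw [res_insert, h.q_eq, h.r_eq, inner_res_left, res_res]
  · simp only [AOLS.addColumn]
    rw [res_insert, h.q_eq, h.t_eq, real_inner_smul_right, norm_smul, smul_smul,
      real_inner_comm (res (col A) st.S (col A j)), Real.norm_eq_abs, mul_pow, sq_abs]
    congr 2
    field_simp

lemma foldl_addColumn_S (sel : List (Fin m)) (st : State n m) :
    (sel.foldl (addColumn A) st).S = st.S ∪ sel.toFinset := by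
  induction sel generalizing st with
  | nil => simp
  | cons s sel ih => ext; simp [ih, addColumn]

/-- The recursion computes orthogonal projections at least until the residual vanishes. -/
lemma Matches.foldl {N : ℕ} {T : Finset (Fin m)} (hg : Generic (col A) y N)
    (h0 : ∀ S : Finset (Fin m), S.card ≤ N → ¬ T ⊆ S → res (col A) S y ≠ 0)
    (sel : List (Fin m)) (h : Matches A y st) (hn : sel.Nodup) (hd : ∀ j ∈ sel, j ∉ st.S)
    (hc : st.S.card + sel.length ≤ N + 1) :
    T ⊆ (sel.foldl (AOLS.addColumn A) st).S ∨ Matches A y (sel.foldl (AOLS.addColumn A) st) := by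
  induction sel generalizing st with
  | nil => exact Or.inr h
  | cons s sel ih =>
    by_cases hT : T ⊆ st.S
    · left
      rw [foldl_addColumn_S]
      exact hT.trans Finset.subset_union_left
    · have hs : s ∉ st.S := hd s (by simp)
      have hcard : st.S.card ≤ N := by simp at hc; omega
      obtain ⟨g1, g2⟩ := hg st.S hcard s hs
      have := h.addColumn g1 (g2 (h0 _ hcard hT)).1
      rw [List.nodup_cons] at hn
      refine ih this hn.2 (fun j hj => ?_) ?_
      · simp only [AOLS.addColumn, Finset.mem_insert, not_or]
        exact ⟨fun e => hn.1 (e ▸ hj), hd j (by simp [hj])⟩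
      · simp only [AOLS.addColumn, Finset.card_insert_of_notMem hs]
        simp at hc; omega

lemma exists_isSelection (A : Matrix (Fin n) (Fin m) ℝ) (L : ℕ) (st : State n m)
    (h : st.S.card + L ≤ m) : ∃ sel, IsSelection A L st sel := by
  let le : Fin m → Fin m → Bool := fun a b => decide (‖q A st b‖ ≤ ‖q A st a‖)
  let l := (st.Sᶜ.toList).mergeSort le
  have hp : l.Perm st.Sᶜ.toList := List.mergeSort_perm _ _
  have hnd : l.Nodup := hp.nodup_iff.2 (Finset.nodup_toList _)
  have hmem : ∀ j, j ∈ l ↔ j ∉ st.S := fun j => by simp [hp.mem_iff]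
  have hlen : L ≤ l.length := by
    rw [hp.length_eq, Finset.length_toList, Finset.card_compl, Fintype.card_fin]; omega
  have hs : l.Pairwise (fun a b => le a b = true) := by
    apply List.pairwise_mergeSort
    · intro a b c hab hbc
      simp only [le, decide_eq_true_eq] at *
      exact hbc.trans hab
    · intro a b
      simp only [le, Bool.or_eq_true, decide_eq_true_eq]
      exact le_total _ _
  rw [← List.take_append_drop L l, List.pairwise_append] at hs
  refine ⟨l.take L, hnd.sublist (List.take_sublist _ _), by simp [hlen], fun j hj => ?_,
    fun j hj b hb hbl => ?_⟩
  · exact (hmem j).1 (List.mem_of_mem_take hj)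
  · have hb' : b ∈ l.drop L := by
      have := (hmem b).2 hb
      rw [← List.take_append_drop L l, List.mem_append] at this
      exact this.resolve_left hbl
    simpa [le] using hs.2.2 j hj b hb'

lemma Reaches.card {k L : ℕ} {ε : ℝ} {i : ℕ} (h : Reaches A y k L ε i st) :
    st.S.card = i * L := by
  induction h with
  | start => simp [init]
  | @iterate i st sel h hc hs ih =>
    rw [foldl_addColumn_S, Finset.card_union_of_disjoint, ih, List.toFinset_card_of_nodup hs.1,
      hs.2.1]
    · ring
    · rw [Finset.disjoint_right]
      intro j hj
      exact hs.2.2.1 j (by simpa using hj)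

/-- There are enough columns for `k` selections, so the algorithm comes to an end. -/
lemma exists_isOutput {k L : ℕ} {ε : ℝ} (hkL : k * L ≤ m) : ∃ S, IsOutput A y k L ε S := by
  suffices H : ∀ d i (st : State n m), i + d = k → Reaches A y k L ε i st →
      ∃ S, IsOutput A y k L ε S from H k 0 _ (by simp) .start
  intro d
  induction d with
  | zero =>
    intro i st hi h
    exact ⟨_, i, st, h, fun hc => by have := hc.2; omega, rfl⟩
  | succ d ih =>
    intro i st hi h
    by_cases hc : Continues k ε i st
    · have : st.S.card + L ≤ m := by
        rw [h.card]
        have : (i + 1) * L ≤ k * L := Nat.mul_le_mul_right _ (by omega)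
        linarith
      obtain ⟨sel, hsel⟩ := exists_isSelection A L st this
      exact ih (i + 1) _ (by omega) (h.iterate hc hsel)
    · exact ⟨_, i, st, h, hc, rfl⟩

/-- Properties of the columns, of the signal and of the noise under which the algorithm cannot
fail. The constants `κ` and `c₀` bound the conditioning of the columns and the correlation of
the residual with columns outside the support.
* `generic`: there are no ties and no divisions by zero before the support is found;
* `lower`: the part of the signal that is not selected is not shrunk much by the projections;
* `col_lower`, `col_upper`: bounds for the columns and their projections;
* `incoherent`: if `j` does not belong to the support, the residuals of the runs without `j`
  are almost orthogonal to the column `j`. -/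
structure Good (c : Fin m → EuclideanSpace ℝ (Fin n)) (x : Fin m → ℝ)
    (y : EuclideanSpace ℝ (Fin n)) (k L : ℕ) (κ c₀ : ℝ) : Prop where
  generic : Generic c y (k * L)
  lower : ∀ S : Finset (Fin m), S.card ≤ k * L →
    κ * √(∑ j ∈ Sᶜ, x j ^ 2) ≤ ‖res c S (∑ j ∈ Sᶜ, x j • c j)‖
  col_lower : ∀ S : Finset (Fin m), S.card ≤ k * L → ∀ j ∉ S, 1 / 2 ≤ ‖res c S (c j)‖
  col_upper : ∀ j, ‖c j‖ ≤ 2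
  incoherent : ∀ j, x j = 0 → ∀ i < k, ∀ S, Run c y L (Finset.univ.erase j) i S →
    |⟪c j, res c S y⟫| ≤ c₀ * ‖res c S y‖ / √k

section Residual

variable {E : Type*} [NormedAddCommGroup E] [InnerProductSpace ℝ E] [FiniteDimensional ℝ E]
  {ι : Type*} [Fintype ι] [DecidableEq ι]

lemma res_sum_add (c : ι → E) (x : ι → ℝ) (ν : E) (S : Finset ι) :
    res c S (∑ j, x j • c j + ν) = res c S (∑ j ∈ Sᶜ, x j • c j) + res c S ν := by
  rw [map_add, ← Finset.sum_add_sum_compl S, map_add]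
  have : res c S (∑ j ∈ S, x j • c j) = 0 := by
    rw [map_sum]
    refine Finset.sum_eq_zero fun j hj => ?_
    rw [map_smul, res_apply_of_mem hj, smul_zero]
  rw [this, zero_add]

/-- If a column of the support is missing, the noise is smaller than the projection of the missing
part of the signal. -/
lemma noise_le {c : ι → E} {x : ι → ℝ} {ν : E} {S : Finset ι} {κ θ C₄ : ℝ}
    (hlow : κ * √(∑ j ∈ Sᶜ, x j ^ 2) ≤ ‖res c S (∑ j ∈ Sᶜ, x j • c j)‖)
    (hκ : 0 < κ) (hθ : 0 ≤ θ) (hc : 1 ≤ θ * κ * C₄) {j : ι}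
    (hjS : j ∉ S) (hν : C₄ * ‖ν‖ ≤ |x j|) :
    κ * |x j| ≤ ‖res c S (∑ j ∈ Sᶜ, x j • c j)‖ ∧
      ‖res c S ν‖ ≤ θ * ‖res c S (∑ j ∈ Sᶜ, x j • c j)‖ := by
  have h1 : |x j| ≤ √(∑ j ∈ Sᶜ, x j ^ 2) := by
    apply Real.le_sqrt_of_sq_le
    rw [sq_abs]
    exact Finset.single_le_sum (f := fun j => x j ^ 2) (fun _ _ => sq_nonneg _) (by simpa using hjS)
  have h2 : κ * |x j| ≤ ‖res c S (∑ j ∈ Sᶜ, x j • c j)‖ :=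
    (mul_le_mul_of_nonneg_left h1 hκ.le).trans hlow
  refine ⟨h2, ?_⟩
  calc ‖res c S ν‖ ≤ 1 * ‖ν‖ := by rw [one_mul]; exact norm_res_le _ _ _
    _ ≤ θ * κ * C₄ * ‖ν‖ := by gcongr
    _ = θ * κ * (C₄ * ‖ν‖) := by ring
    _ ≤ θ * κ * |x j| := by gcongr
    _ = θ * (κ * |x j|) := by ring
    _ ≤ _ := by gcongr

/-- Some missing column of the support has a large inner product with the residual. -/
lemma le_sqrt_mul_of_forall_abs_inner_le {c : ι → E} {x : ι → ℝ} {ν : E} {S : Finset ι}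
    {κ θ M : ℝ} {k : ℕ}
    (hlow : κ * √(∑ j ∈ Sᶜ, x j ^ 2) ≤ ‖res c S (∑ j ∈ Sᶜ, x j • c j)‖) (hκ : 0 < κ)
    (hk : (Finset.univ.filter fun j => x j ≠ 0).card ≤ k)
    (hz : 0 < ‖res c S (∑ j ∈ Sᶜ, x j • c j)‖)
    (hν : ‖res c S ν‖ ≤ θ * ‖res c S (∑ j ∈ Sᶜ, x j • c j)‖)
    (hM0 : 0 ≤ M)
    (hM : ∀ j ∉ S, x j ≠ 0 → |⟪c j, res c S (∑ j, x j • c j + ν)⟫| ≤ M) :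
    (1 - θ) * κ * ‖res c S (∑ j ∈ Sᶜ, x j • c j)‖ ≤ √k * M := by
  set z := ∑ j ∈ Sᶜ, x j • c j with hzdef
  set r := res c S (∑ j, x j • c j + ν) with hr
  have hrz : r = res c S z + res c S ν := res_sum_add c x ν S
  have h1 : (1 - θ) * ‖res c S z‖ ^ 2 ≤ ⟪z, r⟫ := by
    have e1 : ⟪z, r⟫ = ‖res c S z‖ ^ 2 + ⟪res c S z, res c S ν⟫ := by
      rw [hrz, inner_add_right, ← real_inner_self_eq_norm_sq, inner_res_res, inner_res_res]
    have e2 : |⟪res c S z, res c S ν⟫| ≤ ‖res c S z‖ * ‖res c S ν‖ := abs_real_inner_le_norm _ _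
    have e3 := mul_le_mul_of_nonneg_left hν hz.le
    have e4 := neg_abs_le ⟪res c S z, res c S ν⟫
    nlinarith
  set B := Sᶜ.filter fun j => x j ≠ 0 with hB
  have h2 : ⟪z, r⟫ ≤ (∑ j ∈ B, |x j|) * M := by
    rw [hzdef, sum_inner, Finset.sum_mul, hB, Finset.sum_filter]
    refine Finset.sum_le_sum fun j hj => ?_
    rw [real_inner_smul_left]
    split_ifs with hx
    · calc x j * ⟪c j, r⟫ ≤ |x j * ⟪c j, r⟫| := le_abs_self _
        _ = |x j| * |⟪c j, r⟫| := abs_mul _ _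
        _ ≤ _ := by gcongr; exact hM j (by simpa using hj) hx
    · simp [not_not.1 hx]
  have h3 : ∑ j ∈ B, |x j| ≤ √k * √(∑ j ∈ Sᶜ, x j ^ 2) := by
    rw [← Real.sqrt_mul (by positivity)]
    apply Real.le_sqrt_of_sq_le
    calc (∑ j ∈ B, |x j|) ^ 2 ≤ B.card * ∑ j ∈ B, |x j| ^ 2 := sq_sum_le_card_mul_sum_sq
      _ ≤ k * ∑ j ∈ Sᶜ, x j ^ 2 := by
        simp only [sq_abs]
        gcongr
        · exact (Finset.card_le_card (Finset.filter_subset_filter _ (Finset.subset_univ _))).trans hk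
        · exact Finset.filter_subset _ _
  set Q := √(∑ j ∈ Sᶜ, x j ^ 2)
  have h4 : κ * ((1 - θ) * ‖res c S z‖ ^ 2) ≤ √k * M * ‖res c S z‖ := by
    calc κ * ((1 - θ) * ‖res c S z‖ ^ 2) ≤ κ * ((∑ j ∈ B, |x j|) * M) :=
          mul_le_mul_of_nonneg_left (h1.trans h2) hκ.le
      _ ≤ κ * ((√k * Q) * M) := by gcongr
      _ = √k * M * (κ * Q) := by ring
      _ ≤ _ := by gcongr
  have : ((1 - θ) * κ * ‖res c S z‖) * ‖res c S z‖ ≤ √k * M * ‖res c S z‖ := by linarith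
  exact le_of_mul_le_mul_right this hz

end Residual

/-- The deterministic part of the recovery theorem. -/
theorem Good.recovers {x : Fin m → ℝ} {ν : EuclideanSpace ℝ (Fin n)} {k L : ℕ}
    {κ c₀ θ C₄ C₅ ε : ℝ} (hG : Good (col A) x (measurements A x ν) k L κ c₀)
    (hL : 1 ≤ L) (hk : 1 ≤ k) (hkL : k * L ≤ m)
    (hx : (Finset.univ.filter fun j => x j ≠ 0).card ≤ k)
    (hκ : 0 < κ) (hθ : 0 ≤ θ) (hθ1 : θ < 1) (hc : 1 ≤ θ * κ * C₄)
    (hC₅ : C₅ ≤ (1 - θ) * κ) (hc₀ : 0 ≤ c₀) (hc₀' : 4 * c₀ * (1 + θ) < (1 - θ) * κ)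
    (hε : ∀ j, x j ≠ 0 → ε ≤ C₅ * |x j|) (hν : ∀ j, x j ≠ 0 → C₄ * ‖ν‖ ≤ |x j|) :
    Recovers A (measurements A x ν) k L ε x := by
  set y := measurements A x ν with hy
  have hy' : y = ∑ j, x j • col A j + ν := measurements_eq A x ν
  set T := Finset.univ.filter fun j => x j ≠ 0 with hT
  -- As long as an index of the support is missing, the residual exceeds the threshold.
  have hmissing : ∀ S : Finset (Fin m), S.card ≤ k * L → ∀ j ∉ S, x j ≠ 0 →
      0 < ‖res (col A) S (∑ j ∈ Sᶜ, x j • col A j)‖ ∧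
      ‖res (col A) S ν‖ ≤ θ * ‖res (col A) S (∑ j ∈ Sᶜ, x j • col A j)‖ ∧
      (1 - θ) * κ * |x j| ≤ ‖res (col A) S y‖ ∧
      ‖res (col A) S y‖ ≤ (1 + θ) * ‖res (col A) S (∑ j ∈ Sᶜ, x j • col A j)‖ := by
    intro S hS j hj hxj
    obtain ⟨h1, h2⟩ := noise_le (hG.lower S hS) hκ hθ hc hj (hν j hxj)
    have hpos : 0 < κ * |x j| := mul_pos hκ (abs_pos.2 hxj)
    refine ⟨hpos.trans_le h1, h2, ?_, ?_⟩
    · rw [hy', res_sum_add]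
      have := norm_sub_le_norm_add (res (col A) S (∑ j ∈ Sᶜ, x j • col A j)) (res (col A) S ν)
      have h3 := mul_le_mul_of_nonneg_left h1 (sub_nonneg.2 hθ1.le)
      linarith
    · rw [hy', res_sum_add]
      refine (norm_add_le _ _).trans ?_
      linarith
  have h0 : ∀ S : Finset (Fin m), S.card ≤ k * L → ¬ T ⊆ S → res (col A) S y ≠ 0 := by
    intro S hS hTS
    obtain ⟨j, hjT, hjS⟩ := Finset.not_subset.1 hTS
    have hxj : x j ≠ 0 := by simpa [hT] using hjT
    have := (hmissing S hS j hjS hxj).2.2.1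
    have hpos : 0 < (1 - θ) * κ * |x j| := mul_pos (mul_pos (by linarith) hκ) (abs_pos.2 hxj)
    exact norm_pos_iff.1 (hpos.trans_le this)
  have hinv : ∀ i st, Reaches A y k L ε i st → T ⊆ st.S ∨
      (Matches A y st ∧ i ≤ (T ∩ st.S).card ∧ Run (col A) y L Finset.univ i st.S) := by
    intro i st h
    induction h with
    | start => exact Or.inr ⟨matches_init, Nat.zero_le _, rfl⟩
    | @iterate i st sel h hcont hs ih =>
      have hS' := foldl_addColumn_S (A := A) sel st
      rcases ih with ih | ⟨hmat, hcardT, hrun⟩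
      · left; rw [hS']; exact ih.trans Finset.subset_union_left
      by_cases hTS : T ⊆ st.S
      · left; rw [hS']; exact hTS.trans Finset.subset_union_left
      have hcard' : st.S.card + L ≤ k * L := by
        rw [h.card]
        have : (i + 1) * L ≤ k * L := Nat.mul_le_mul_right _ hcont.2
        linarith
      have hcard : st.S.card ≤ k * L := by omega
      have hr := h0 st.S hcard hTS
      rcases hmat.foldl hG.generic h0 sel hs.1 hs.2.2.1 (by rw [hs.2.1]; omega) with hl | hmat'
      · exact Or.inl hl
      right
      -- Some index of the support is among the selected ones.
      obtain ⟨j, hjsel, hjT⟩ : ∃ j ∈ sel, x j ≠ 0 := by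
        by_contra! hno
        obtain ⟨a, ha⟩ : ∃ a, a ∈ sel :=
          List.exists_mem_of_ne_nil _ (by rintro rfl; have := hs.2.1; simp at this; omega)
        have haS : a ∉ st.S := hs.2.2.1 a ha
        have hinc := hG.incoherent a (hno a ha) i hcont.2 st.S (hrun.erase haS)
        have hlowa := hG.col_lower st.S hcard a haS
        obtain ⟨j₀, hj₀T, hj₀S⟩ := Finset.not_subset.1 hTS
        obtain ⟨hz, hnoise, -, hup⟩ := hmissing st.S hcard j₀ hj₀S (by simpa [hT] using hj₀T)
        have hk0 : 0 < √(k : ℝ) := Real.sqrt_pos.2 (by exact_mod_cast hk)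
        set ρ := ‖res (col A) st.S y‖
        have hM : ∀ j ∉ st.S, x j ≠ 0 →
            |⟪col A j, res (col A) st.S (∑ j, x j • col A j + ν)⟫| ≤ 4 * c₀ * ρ / √k := by
          intro j hj hxj
          rw [← hy']
          have hjsel : j ∉ sel := fun h => hxj (hno j h)
          have hle := hs.2.2.2 a ha j hj hjsel
          rw [hmat.norm_q, hmat.norm_q, score, score] at hle
          have hp : 0 < ‖res (col A) st.S (col A j)‖ := by
            have := hG.col_lower st.S hcard j hj
            linarith
          rw [div_le_iff₀ hp] at hle
          calc _ ≤ _ := hle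
            _ ≤ (c₀ * ρ / √k) / (1 / 2) * 2 := by
              gcongr
              exact (norm_res_le _ _ _).trans (hG.col_upper j)
            _ = _ := by ring
        have hfin := le_sqrt_mul_of_forall_abs_inner_le (hG.lower st.S hcard) hκ hx hz hnoise
          (by positivity) hM
        rw [mul_div_cancel₀ _ hk0.ne'] at hfin
        have h5 : 4 * c₀ * ρ ≤ 4 * c₀ * ((1 + θ) *
            ‖res (col A) st.S (∑ j ∈ st.Sᶜ, x j • col A j)‖) := by gcongr
        have h6 := mul_lt_mul_of_pos_right hc₀' hz
        linarith
      refine ⟨hmat', ?_, st.S, hrun, hr, ?_⟩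
      · have hsub : insert j (T ∩ st.S) ⊆ T ∩ (sel.foldl (addColumn A) st).S := by
          rw [hS']
          intro a
          simp only [Finset.mem_insert, Finset.mem_inter, Finset.mem_union, List.mem_toFinset, hT,
            Finset.mem_filter, Finset.mem_univ, true_and]
          rintro (rfl | ⟨h1, h2⟩)
          · exact ⟨hjT, Or.inr hjsel⟩
          · exact ⟨h1, Or.inl h2⟩
        have := Finset.card_le_card hsub
        rw [Finset.card_insert_of_notMem] at this
        · omega
        · simp [hs.2.2.1 j hjsel]
      · have hdisj : Disjoint st.S sel.toFinset := by
          rw [Finset.disjoint_right]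
          intro a ha
          exact hs.2.2.1 a (by simpa using ha)
        refine ⟨by rw [hS']; exact Finset.subset_union_left, fun _ _ => by simp, ?_, ?_⟩
        · rw [hS', Finset.card_union_of_disjoint hdisj, List.toFinset_card_of_nodup hs.1, hs.2.1]
        · intro a ha b hb
          rw [← hmat.norm_q, ← hmat.norm_q]
          simp only [hS', Finset.mem_sdiff, Finset.mem_union, List.mem_toFinset, Finset.mem_univ,
            true_and, not_or] at ha hb
          exact hs.2.2.2 a (ha.1.resolve_left ha.2) b hb.1 hb.2
  refine ⟨exists_isOutput hkL, ?_⟩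
  rintro S ⟨i, st, hreach, hguard, rfl⟩ j hj
  have hik : i ≤ k := by
    cases hreach with
    | start => exact Nat.zero_le _
    | iterate _ h _ => exact h.2
  suffices hTS : T ⊆ st.S from hTS (by simpa [hT] using hj)
  rcases hinv i st hreach with h | ⟨hmat, hcardT, -⟩
  · exact h
  by_contra hTS
  obtain ⟨j₀, hj₀T, hj₀S⟩ := Finset.not_subset.1 hTS
  have hxj : x j₀ ≠ 0 := by simpa [hT] using hj₀T
  have hcard : st.S.card ≤ k * L := by rw [hreach.card]; exact Nat.mul_le_mul_right _ hik
  have h1 := (hmissing st.S hcard j₀ hj₀S hxj).2.2.1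
  have h2 : ε ≤ ‖st.r‖ := by
    rw [hmat.r_eq]
    exact (hε j₀ hxj).trans (le_trans (by gcongr) h1)
  have hik' : i = k := le_antisymm hik (not_lt.1 fun h => hguard ⟨h2, h⟩)
  refine hTS ?_
  have : T ∩ st.S = T := Finset.eq_of_subset_of_card_le Finset.inter_subset_left (by omega)
  exact Finset.inter_eq_left.1 this

end Deterministic

/-! ### Resampling and Gaussian vectors -/

section Resample

variable {ι : Type*} [Fintype ι] [DecidableEq ι] {α : ι → Type*} [∀ i, MeasurableSpace (α i)]

/-- Replacing some coordinates of a point of a product space by those of an independent copy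
does not change its law. -/
lemma measurePreserving_piecewise (μ : ∀ i, Measure (α i)) [∀ i, IsProbabilityMeasure (μ i)]
    (U : Finset ι) :
    MeasurePreserving (fun p : (∀ i, α i) × (∀ i, α i) => U.piecewise p.2 p.1)
      ((Measure.pi μ).prod (Measure.pi μ)) (Measure.pi μ) := by
  have hm : Measurable (fun p : (∀ i, α i) × (∀ i, α i) => U.piecewise p.2 p.1) := by
    rw [measurable_pi_iff]
    intro i
    by_cases hi : i ∈ U
    · simp only [Finset.piecewise, hi, if_true]; fun_prop
    · simp only [Finset.piecewise, hi, if_false]; fun_prop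
  refine ⟨hm, (Measure.pi_eq fun s hs => ?_).symm⟩
  rw [Measure.map_apply hm (.univ_pi hs)]
  have : (fun p : (∀ i, α i) × (∀ i, α i) => U.piecewise p.2 p.1) ⁻¹' Set.univ.pi s =
      (Set.univ.pi fun i => if i ∈ U then Set.univ else s i) ×ˢ
        (Set.univ.pi fun i => if i ∈ U then s i else Set.univ) := by
    ext p
    simp only [Set.mem_preimage, Set.mem_pi, Set.mem_univ, true_imp_iff, Set.mem_prod,
      Finset.piecewise, ← forall_and]
    refine forall_congr' fun i => ?_
    by_cases hi : i ∈ U <;> simp [hi]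
  rw [this, Measure.prod_prod, Measure.pi_pi, Measure.pi_pi, ← Finset.prod_mul_distrib]
  refine Finset.prod_congr rfl fun i _ => ?_
  by_cases hi : i ∈ U <;> simp [hi]

/-- Fubini's theorem for the coordinates in `U`, in terms of resampling. -/
lemma pi_eq_lintegral_piecewise (μ : ∀ i, Measure (α i)) [∀ i, IsProbabilityMeasure (μ i)]
    (U : Finset ι) {B : Set (∀ i, α i)} (hB : MeasurableSet B) :
    Measure.pi μ B = ∫⁻ c, Measure.pi μ {c' | U.piecewise c' c ∈ B} ∂Measure.pi μ := by
  have h := measurePreserving_piecewise μ U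
  rw [← h.measure_preimage hB.nullMeasurableSet, Measure.prod_apply (h.measurable hB)]
  rfl

/-- Fubini's theorem for the coordinate `j`, in terms of resampling. -/
lemma pi_eq_lintegral_update (μ : ∀ i, Measure (α i)) [∀ i, IsProbabilityMeasure (μ i)]
    (j : ι) {B : Set (∀ i, α i)} (hB : MeasurableSet B) :
    Measure.pi μ B = ∫⁻ c, μ j {a | Function.update c j a ∈ B} ∂Measure.pi μ := by
  rw [pi_eq_lintegral_piecewise μ {j} hB]
  refine lintegral_congr fun c => ?_
  have hm : MeasurableSet {a | Function.update c j a ∈ B} := measurable_update c hB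
  rw [← (measurePreserving_eval μ j).measure_preimage hm.nullMeasurableSet]
  congr 1
  ext c'
  simp [Finset.piecewise_singleton]

end Resample

section Gaussian

variable {E : Type*} [NormedAddCommGroup E] [InnerProductSpace ℝ E] [FiniteDimensional ℝ E]
  [MeasurableSpace E] [BorelSpace E]

lemma ofReal_norm_smul_sq {F : Type*} [NormedAddCommGroup F] [NormedSpace ℝ F] (s : ℝ) (t : F) :
    ((‖s • t‖ : ℝ) : ℂ) ^ 2 = (s : ℂ) ^ 2 * (‖t‖ : ℂ) ^ 2 := by
  rw [norm_smul, Real.norm_eq_abs, ← Complex.ofReal_pow, mul_pow, sq_abs]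
  push_cast
  rfl

lemma map_orthogonalProjectionOnto_stdGaussian (W : Submodule ℝ E) :
    (stdGaussian E).map W.orthogonalProjectionOnto = stdGaussian W := by
  have : IsProbabilityMeasure ((stdGaussian E).map W.orthogonalProjectionOnto) :=
    Measure.isProbabilityMeasure_map (by fun_prop)
  apply Measure.ext_of_charFun
  ext t
  rw [charFun_stdGaussian, charFun_apply, integral_map (by fun_prop) (by fun_prop)]
  have : ∀ x : E, ⟪W.orthogonalProjectionOnto x, t⟫ = ⟪x, (t : E)⟫ := fun x => by simp
  simp_rw [this]
  rw [← charFun_apply, charFun_stdGaussian]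
  simp

lemma integral_exp_mul_sq_gaussianReal {t : ℝ} (ht : t < 1 / 2) :
    ∫ x, Real.exp (t * x ^ 2) ∂gaussianReal 0 1 = (√(1 - 2 * t))⁻¹ := by
  rw [integral_gaussianReal_eq_integral_smul one_ne_zero]
  have : ∀ x : ℝ, gaussianPDFReal 0 1 x • Real.exp (t * x ^ 2) =
      (√(2 * Real.pi))⁻¹ * Real.exp (-(1 / 2 - t) * x ^ 2) := by
    intro x
    rw [gaussianPDFReal, smul_eq_mul, mul_assoc, ← Real.exp_add]
    simp only [NNReal.coe_one, mul_one, sub_zero]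
    congr 2
    ring
  simp_rw [this]
  rw [integral_const_mul, integral_gaussian, ← Real.sqrt_inv, ← Real.sqrt_inv,
    ← Real.sqrt_mul (by positivity)]
  congr 1
  have h1 : 1 - 2 * t ≠ 0 := by linarith
  have h2 : 1 / 2 - t ≠ 0 := by linarith
  field_simp

lemma mgf_norm_sq_stdGaussian {t : ℝ} (ht : t < 1 / 2) :
    mgf (fun g : E => ‖g‖ ^ 2) (stdGaussian E) t =
      ((√(1 - 2 * t))⁻¹) ^ Module.finrank ℝ E := by
  rw [mgf, stdGaussian, integral_map (Measurable.aemeasurable (by fun_prop)) (by fun_prop)]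
  have : ∀ x : Fin (Module.finrank ℝ E) → ℝ,
      Real.exp (t * ‖∑ i, x i • stdOrthonormalBasis ℝ E i‖ ^ 2) =
        ∏ i, Real.exp (t * x i ^ 2) := by
    intro x
    rw [← Real.exp_sum, ← Finset.mul_sum, ← real_inner_self_eq_norm_sq,
      (stdOrthonormalBasis ℝ E).orthonormal.inner_sum]
    simp [sq]
  simp_rw [this]
  rw [integral_fintype_prod_eq_prod (f := fun _ (x : ℝ) => Real.exp (t * x ^ 2))]
  simp [integral_exp_mul_sq_gaussianReal ht]

lemma integrable_exp_mul_norm_sq_stdGaussian {t : ℝ} (ht : t < 1 / 2) :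
    Integrable (fun g : E => Real.exp (t * ‖g‖ ^ 2)) (stdGaussian E) := by
  apply Integrable.of_integral_ne_zero
  have h := mgf_norm_sq_stdGaussian (E := E) ht
  rw [mgf] at h
  rw [h]
  have : 0 < √(1 - 2 * t) := Real.sqrt_pos.2 (by linarith)
  positivity

/-- The Chernoff bound for the lower tail of the chi-squared distribution. -/
lemma stdGaussian_norm_sq_le {t a : ℝ} (ht : 0 ≤ t) :
    (stdGaussian E).real {g | ‖g‖ ^ 2 ≤ a} ≤
      Real.exp (t * a) * ((√(1 + 2 * t))⁻¹) ^ Module.finrank ℝ E := by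
  have h := measure_le_le_exp_mul_mgf (μ := stdGaussian E) (X := fun g : E => ‖g‖ ^ 2) (t := -t) a
    (by linarith) (integrable_exp_mul_norm_sq_stdGaussian (by linarith))
  rw [mgf_norm_sq_stdGaussian (by linarith)] at h
  convert h using 3 <;> ring_nf

/-- A bound for the lower tail of a chi-squared distribution with at least `(1 - δ / 4) n` degrees
of freedom, below a fraction of `n`. -/
lemma stdGaussian_norm_le_exp {δ : ℝ} {n : ℕ} (hδ : 0 < δ) (hδ1 : δ < 1)
    (hd : (1 - δ / 4) * n ≤ Module.finrank ℝ E) :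
    (stdGaussian E).real {g | ‖g‖ ≤ (1 - δ) * √n} ≤ Real.exp (-(δ ^ 2 / 8 * n)) := by
  have hsub : {g : E | ‖g‖ ≤ (1 - δ) * √n} ⊆ {g | ‖g‖ ^ 2 ≤ (1 - δ) ^ 2 * n} := by
    intro g hg
    have := pow_le_pow_left₀ (norm_nonneg g) (Set.mem_ofPred.1 hg) 2
    rwa [mul_pow, Real.sq_sqrt (Nat.cast_nonneg n)] at this
  refine (measureReal_mono hsub).trans ((stdGaussian_norm_sq_le (t := δ / 4) (by linarith)).trans ?_)
  set d := Module.finrank ℝ E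
  have h1 : (√(1 + 2 * (δ / 4)))⁻¹ ≤ Real.exp (-(δ / 4 * (1 - δ / 4))) := by
    rw [Real.exp_neg]
    apply inv_anti₀ (Real.exp_pos _)
    apply Real.le_sqrt_of_sq_le
    rw [← Real.exp_nat_mul]
    have hlog : 2 * (δ / 4 * (1 - δ / 4)) ≤ Real.log (1 + 2 * (δ / 4)) := by
      refine le_trans ?_ (Real.le_log_one_add_of_nonneg (x := 2 * (δ / 4)) (by linarith))
      rw [le_div_iff₀ (by linarith)]
      have : 0 < δ ^ 3 := by positivity
      nlinarith
    calc Real.exp ((2 : ℕ) * (δ / 4 * (1 - δ / 4))) ≤ Real.exp (Real.log (1 + 2 * (δ / 4))) := by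
          apply Real.exp_le_exp.2; simpa using hlog
      _ = _ := Real.exp_log (by linarith)
  calc Real.exp (δ / 4 * ((1 - δ) ^ 2 * n)) * ((√(1 + 2 * (δ / 4)))⁻¹) ^ d
      ≤ Real.exp (δ / 4 * ((1 - δ) ^ 2 * n)) * (Real.exp (-(δ / 4 * (1 - δ / 4)))) ^ d := by
        gcongr
    _ = Real.exp (δ / 4 * ((1 - δ) ^ 2 * n) - δ / 4 * (1 - δ / 4) * d) := by
        rw [← Real.exp_nat_mul, ← Real.exp_add]; congr 1; ring
    _ ≤ _ := by
        apply Real.exp_le_exp.2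
        have h2 : δ / 4 * (1 - δ / 4) * ((1 - δ / 4) * n) ≤ δ / 4 * (1 - δ / 4) * d := by
          apply mul_le_mul_of_nonneg_left hd
          nlinarith
        have h3 : 0 ≤ (n : ℝ) * (δ ^ 2 * (1 - δ)) :=
          mul_nonneg (Nat.cast_nonneg n) (mul_nonneg (sq_nonneg _) (by linarith))
        nlinarith

lemma stdGaussian_le_norm_exp :
    (stdGaussian E).real {g | 2 * √(Module.finrank ℝ E) ≤ ‖g‖} ≤
      Real.exp (-(1 / 2 * Module.finrank ℝ E)) := by
  set d := Module.finrank ℝ E with hd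
  have hsub : {g : E | 2 * √d ≤ ‖g‖} ⊆ {g | 4 * d ≤ ‖g‖ ^ 2} := by
    intro g hg
    have := pow_le_pow_left₀ (by positivity) (Set.mem_ofPred.1 hg) 2
    rw [mul_pow, Real.sq_sqrt (Nat.cast_nonneg d)] at this
    norm_num at this
    exact this
  refine (measureReal_mono hsub).trans ?_
  have h := measure_ge_le_exp_mul_mgf (μ := stdGaussian E) (X := fun g : E => ‖g‖ ^ 2)
    (t := 1 / 4) (4 * d) (by norm_num) (integrable_exp_mul_norm_sq_stdGaussian (by norm_num))
  refine h.trans ?_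
  rw [mgf_norm_sq_stdGaussian (by norm_num), ← hd]
  have h1 : (√(1 - 2 * (1 / 4)))⁻¹ ≤ Real.exp (1 / 2) := by
    rw [← Real.sqrt_inv]
    apply Real.sqrt_le_iff.2 ⟨(Real.exp_pos _).le, ?_⟩
    rw [← Real.exp_nat_mul]
    have := Real.add_one_le_exp (1 : ℝ)
    norm_num at this ⊢
    linarith
  calc _ ≤ Real.exp (-(1 / 4) * (4 * d)) * (Real.exp (1 / 2)) ^ d := by gcongr
    _ = _ := by rw [← Real.exp_nat_mul, ← Real.exp_add]; congr 1; ring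

lemma map_inner_stdGaussian (r : E) :
    (stdGaussian E).map (fun g => ⟪g, r⟫) = gaussianReal 0 (‖r‖₊ ^ 2) := by
  have : IsProbabilityMeasure ((stdGaussian E).map (fun g => ⟪g, r⟫)) :=
    Measure.isProbabilityMeasure_map (by fun_prop)
  apply Measure.ext_of_charFun
  ext t
  rw [charFun_gaussianReal, charFun_apply, integral_map (by fun_prop) (by fun_prop)]
  have : ∀ x : E, ⟪⟪x, r⟫, t⟫ = ⟪x, t • r⟫ := fun x => by simp [real_inner_smul_right]
  simp_rw [this]
  rw [← charFun_apply, charFun_stdGaussian, ofReal_norm_smul_sq]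
  congr 1
  simp
  ring

lemma stdGaussian_abs_inner_gt {a : ℝ} (ha : 0 ≤ a) (r : E) :
    (stdGaussian E).real {g | a * ‖r‖ < |⟪g, r⟫|} ≤ 2 * Real.exp (-(a ^ 2 / 2)) := by
  by_cases hr : r = 0
  · simp [hr]; positivity
  have hr' : 0 < ‖r‖ := norm_pos_iff.2 hr
  have key : ∀ s : E, ‖s‖ = ‖r‖ →
      (stdGaussian E).real {g | a * ‖r‖ ≤ ⟪g, s⟫} ≤ Real.exp (-(a ^ 2 / 2)) := by
    intro s hs
    have hint : Integrable (fun g : E => Real.exp (a / ‖r‖ * ⟪g, s⟫)) (stdGaussian E) := by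
      have := integrable_exp_mul_gaussianReal (μ := 0) (v := ‖s‖₊ ^ 2) (a / ‖r‖)
      rw [← map_inner_stdGaussian] at this
      exact this.comp_measurable (by fun_prop)
    have h := measure_ge_le_exp_mul_mgf (μ := stdGaussian E) (X := fun g : E => ⟪g, s⟫)
      (t := a / ‖r‖) (a * ‖r‖) (by positivity) hint
    rw [mgf_gaussianReal (map_inner_stdGaussian s), ← Real.exp_add] at h
    refine h.trans (Real.exp_le_exp.2 (le_of_eq ?_))
    simp only [NNReal.coe_pow, coe_nnnorm, hs]
    field_simp
    ring
  have hsub : {g : E | a * ‖r‖ < |⟪g, r⟫|} ⊆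
      {g | a * ‖r‖ ≤ ⟪g, r⟫} ∪ {g | a * ‖r‖ ≤ ⟪g, -r⟫} := by
    intro g hg
    rcases lt_abs.1 (Set.mem_ofPred.1 hg) with h | h
    · exact Or.inl h.le
    · right; simp only [Set.mem_ofPred_eq, inner_neg_right]; exact h.le
  refine (measureReal_mono hsub).trans ((measureReal_union_le _ _).trans ?_)
  have h1 := key r rfl
  have h2 := key (-r) (norm_neg r)
  linarith

variable (E) in
/-- The law of `s` times a standard Gaussian vector. -/
noncomputable def colLaw (s : ℝ) : Measure E := (stdGaussian E).map (fun g => s • g)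

instance (s : ℝ) : IsProbabilityMeasure (colLaw E s) :=
  Measure.isProbabilityMeasure_map (by fun_prop)

lemma colLaw_apply (s : ℝ) {B : Set E} (hB : MeasurableSet B) :
    colLaw E s B = stdGaussian E {g | s • g ∈ B} :=
  Measure.map_apply (by fun_prop) hB

lemma charFun_colLaw (s : ℝ) (t : E) :
    charFun (colLaw E s) t = Complex.exp (-((s ^ 2 : ℝ) * ‖t‖ ^ 2) / 2) := by
  rw [colLaw, charFun_map_smul, charFun_stdGaussian, ofReal_norm_smul_sq]
  simp

/-- A linear combination of independent Gaussian vectors. -/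
lemma map_sum_smul_pi_colLaw {ι : Type*} [Fintype ι] (s : ℝ) (v : ι → ℝ) :
    (Measure.pi fun _ : ι => colLaw E s).map (fun c => ∑ j, v j • c j) =
      colLaw E (s * √(∑ j, v j ^ 2)) := by
  have : IsProbabilityMeasure
      ((Measure.pi fun _ : ι => colLaw E s).map (fun c => ∑ j, v j • c j)) :=
    Measure.isProbabilityMeasure_map (Measurable.aemeasurable (by fun_prop))
  apply Measure.ext_of_charFun
  ext t
  rw [charFun_colLaw]
  have hind : iIndepFun (fun j (c : ι → E) => v j • c j) (Measure.pi fun _ : ι => colLaw E s) :=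
    iIndepFun_pi (X := fun j (a : E) => v j • a) (fun j => by fun_prop)
  rw [hind.charFun_map_fun_sum_eq_prod (fun j => Measurable.aemeasurable (by fun_prop)), Finset.prod_apply]
  have : ∀ j, charFun ((Measure.pi fun _ : ι => colLaw E s).map (fun c => v j • c j)) t =
      Complex.exp (-((s ^ 2 : ℝ) * (v j ^ 2 : ℝ) * ‖t‖ ^ 2) / 2) := by
    intro j
    have h1 : (Measure.pi fun _ : ι => colLaw E s).map (fun c => v j • c j) =
        (colLaw E s).map (fun a => v j • a) := by
      conv_rhs => rw [← (measurePreserving_eval (fun _ : ι => colLaw E s) j).map_eq]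
      rw [Measure.map_map (by fun_prop) (by fun_prop)]
      rfl
    rw [h1, charFun_map_smul, charFun_colLaw, ofReal_norm_smul_sq]
    congr 1
    push_cast
    ring
  simp_rw [this, ← Complex.exp_sum]
  congr 1
  rw [mul_pow, Real.sq_sqrt (Finset.sum_nonneg fun _ _ => sq_nonneg _)]
  push_cast
  rw [← Finset.sum_div, Finset.sum_neg_distrib, ← Finset.sum_mul, ← Finset.mul_sum]

/-- A measurable set that every line in a certain direction meets in finitely many points is a
null set. -/
lemma colLaw_eq_zero_of_finite {s : ℝ} (hs : s ≠ 0) {B : Set E} (hB : MeasurableSet B) {v : E}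
    (hv : v ≠ 0) (h : ∀ a, {t : ℝ | a + t • v ∈ B}.Finite) : colLaw E s B = 0 := by
  classical
  rw [colLaw_apply s hB]
  have hv' : ‖v‖ ≠ 0 := norm_ne_zero_iff.2 hv
  set e := ‖v‖⁻¹ • v
  have he : ‖e‖ = 1 := by simp [e, norm_smul, hv']
  obtain ⟨u, b, hu, hb⟩ := (orthonormal_subsingleton_iff (𝕜 := ℝ)
    (v := ((↑) : ({e} : Set E) → E)).2 (by simp [he])).exists_orthonormalBasis_extension
  have heu : e ∈ u := by simpa using hu
  have hbe : b ⟨e, heu⟩ = e := by rw [hb]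
  rw [stdGaussian_eq_map_pi_orthonormalBasis b]
  have hB' : MeasurableSet {g : E | s • g ∈ B} := (measurable_const_smul s) hB
  have hm : Measurable fun x : u → ℝ => ∑ i, x i • b i := by fun_prop
  have := nullSingletonClass_gaussianReal (μ := 0) (v := 1) one_ne_zero
  rw [Measure.map_apply hm hB', pi_eq_lintegral_update _ ⟨e, heu⟩ (hm hB')]
  refine (lintegral_congr fun x => ?_).trans lintegral_zero
  refine Set.Finite.measure_zero ?_ _
  refine ((h (s • ∑ i, Function.update x ⟨e, heu⟩ 0 i • b i)).preimage
    (f := fun t => s * t * ‖v‖⁻¹) ?_).subset ?_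
  · intro t _ t' _ htt
    have : s * t * ‖v‖⁻¹ = s * t' * ‖v‖⁻¹ := htt
    field_simp at this
    exact this
  · intro t ht
    simp only [Set.mem_preimage, Set.mem_ofPred_eq] at ht ⊢
    convert ht using 1
    have : ∀ t : ℝ, ∑ i, Function.update x ⟨e, heu⟩ t i • b i = t • e +
        ∑ i ∈ Finset.univ.erase ⟨e, heu⟩, x i • b i := by
      intro t
      rw [← Finset.add_sum_erase _ _ (Finset.mem_univ ⟨e, heu⟩)]
      congr 1
      · simp [hbe]
      · refine Finset.sum_congr rfl fun i hi => ?_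
        rw [Function.update_of_ne (Finset.ne_of_mem_erase hi)]
    rw [this, this, zero_smul, zero_add, smul_add, add_comm]
    congr 1
    simp only [e, smul_smul, mul_assoc]

end Gaussian

/-! ### General position and measurability -/

section GeneralPosition

/-- A nonconstant polynomial of degree at most four has finitely many zeros. -/
lemma finite_setOf_quartic_eq_zero {c₀ c₁ c₂ c₃ c₄ : ℝ} (h : c₁ ≠ 0 ∨ c₂ ≠ 0 ∨ c₄ ≠ 0) :
    {t : ℝ | c₀ + c₁ * t + c₂ * t ^ 2 + c₃ * t ^ 3 + c₄ * t ^ 4 = 0}.Finite := by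
  open Polynomial in
  let p : ℝ[X] := C c₀ + C c₁ * X + C c₂ * X ^ 2 + C c₃ * X ^ 3 + C c₄ * X ^ 4
  have hp : p ≠ 0 := by
    intro h0
    have h1 : p.coeff 1 = c₁ := by simp [p, coeff_C]
    have h2 : p.coeff 2 = c₂ := by simp [p]
    have h4 : p.coeff 4 = c₄ := by simp [p]
    simp only [h0, coeff_zero] at h1 h2 h4
    rcases h with h | h | h
    exacts [h h1.symm, h h2.symm, h h4.symm]
  refine (p.roots.toFinset.finite_toSet).subset fun t ht => ?_
  simp only [Finset.mem_coe, Multiset.mem_toFinset, mem_roots hp, IsRoot, p]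
  simpa using ht

variable {E : Type*} [NormedAddCommGroup E] [InnerProductSpace ℝ E] [FiniteDimensional ℝ E]

lemma exists_ne_zero_inner_eq_zero {W : Submodule ℝ E} (hW : 2 ≤ Module.finrank ℝ W) (u : E) :
    ∃ v ∈ W, v ≠ 0 ∧ ⟪u, v⟫ = 0 := by
  let f : W →ₗ[ℝ] ℝ := (innerₗ E u).comp W.subtype
  have : LinearMap.ker f ≠ ⊥ := LinearMap.ker_ne_bot_of_finrank_lt (by rw [Module.finrank_self]; omega)
  obtain ⟨v, hv, hv0⟩ := Submodule.exists_mem_ne_zero_of_ne_bot this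
  exact ⟨v, v.2, by simpa using hv0, by simpa [f] using hv⟩

lemma inner_eq_inner_starProjection {W : Submodule ℝ E} {v : E} (hv : v ∈ W) (a : E) :
    ⟪a, v⟫ = ⟪W.starProjection a, v⟫ := by
  rw [Submodule.inner_starProjection_left_eq_right, Submodule.starProjection_eq_self_iff.2 hv]

variable {W : Submodule ℝ E}

/-- The residual `P (ξ a + w)` is not orthogonal to `a` for a generic vector `a`, where `P` is the
projection onto `W`. -/
lemma exists_line_inner (hW : 2 ≤ Module.finrank ℝ W) (ξ : ℝ) (w : E) :
    ∃ v : E, v ≠ 0 ∧ ∀ a : E, {t : ℝ | W.starProjection (ξ • (a + t • v) + w) ≠ 0 ∧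
      ⟪a + t • v, W.starProjection (ξ • (a + t • v) + w)⟫ = 0}.Finite := by
  by_cases hξ : ξ = 0
  · subst hξ
    simp only [zero_smul, zero_add]
    by_cases hr : W.starProjection w = 0
    · obtain ⟨v, -, hv, -⟩ := exists_ne_zero_inner_eq_zero hW 0
      exact ⟨v, hv, fun a => by simp [hr]⟩
    refine ⟨W.starProjection w, hr, fun a => ?_⟩
    set r := W.starProjection w
    refine (finite_setOf_quartic_eq_zero (c₀ := ⟪a, r⟫) (c₁ := ‖r‖ ^ 2) (c₂ := 0) (c₃ := 0)
      (c₄ := 0) (Or.inl (by positivity))).subset fun t ht => ?_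
    have := ht.2
    rw [inner_add_left, real_inner_smul_left, real_inner_self_eq_norm_sq] at this
    simp only [Set.mem_ofPred_eq]
    linarith
  · obtain ⟨v, hvW, hv, -⟩ := exists_ne_zero_inner_eq_zero hW 0
    refine ⟨v, hv, fun a => ?_⟩
    set r := W.starProjection (ξ • a + w) with hr
    have hv' : W.starProjection v = v := Submodule.starProjection_eq_self_iff.2 hvW
    refine (finite_setOf_quartic_eq_zero (c₀ := ⟪a, r⟫) (c₁ := ξ * ⟪a, v⟫ + ⟪v, r⟫)
      (c₂ := ξ * ‖v‖ ^ 2) (c₃ := 0) (c₄ := 0)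
      (Or.inr (Or.inl (mul_ne_zero hξ (by positivity))))).subset fun t ht => ?_
    have h := ht.2
    have e : W.starProjection (ξ • (a + t • v) + w) = r + (ξ * t) • v := by
      rw [hr, show ξ • (a + t • v) + w = (ξ • a + w) + (ξ * t) • v by
        rw [smul_add, smul_smul]; abel, map_add, map_smul, hv']
    rw [e, inner_add_left, inner_add_right, inner_add_right] at h
    simp only [real_inner_smul_left, real_inner_smul_right, real_inner_self_eq_norm_sq] at h
    simp only [Set.mem_ofPred_eq]
    linarith

/-- The scores of `a` and `b` with respect to the residual `P (ξ a + w)` are distinct for a generic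
vector `a`, where `P` is the projection onto `W`. -/
lemma exists_line_score (hW : 2 ≤ Module.finrank ℝ W) (ξ : ℝ) (w : E) {b : E}
    (hb : W.starProjection b ≠ 0) :
    ∃ v : E, v ≠ 0 ∧ ∀ a : E, {t : ℝ | W.starProjection (ξ • (a + t • v) + w) ≠ 0 ∧
      ⟪a + t • v, W.starProjection (ξ • (a + t • v) + w)⟫ ^ 2 * ‖W.starProjection b‖ ^ 2 =
        ⟪b, W.starProjection (ξ • (a + t • v) + w)⟫ ^ 2 *
          ‖W.starProjection (a + t • v)‖ ^ 2}.Finite := by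
  have hB : 0 < ‖W.starProjection b‖ := norm_pos_iff.2 hb
  set B := ‖W.starProjection b‖
  have hnorm : ∀ v ∈ W, ∀ a : E, ∀ t : ℝ, ‖W.starProjection (a + t • v)‖ ^ 2 =
      ‖W.starProjection a‖ ^ 2 + 2 * t * ⟪a, v⟫ + t ^ 2 * ‖v‖ ^ 2 := by
    intro v hv a t
    rw [map_add, map_smul, Submodule.starProjection_eq_self_iff.2 hv, norm_add_sq_real,
      norm_smul, inner_smul_right, ← inner_eq_inner_starProjection hv, mul_pow, Real.norm_eq_abs,
      sq_abs]
    ring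
  by_cases hξ : ξ = 0
  · subst hξ
    simp only [zero_smul, zero_add]
    set r := W.starProjection w with hrdef
    by_cases hr : r = 0
    · obtain ⟨v, -, hv, -⟩ := exists_ne_zero_inner_eq_zero hW 0
      exact ⟨v, hv, fun a => by simp [hr]⟩
    by_cases hbr : ⟪b, r⟫ = 0
    · refine ⟨r, hr, fun a => ?_⟩
      have : 0 < ‖r‖ := norm_pos_iff.2 hr
      refine (finite_setOf_quartic_eq_zero (c₀ := ⟪a, r⟫ ^ 2 * B ^ 2)
        (c₁ := 2 * ⟪a, r⟫ * ‖r‖ ^ 2 * B ^ 2) (c₂ := ‖r‖ ^ 4 * B ^ 2) (c₃ := 0)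
        (c₄ := 0) (Or.inr (Or.inl (by positivity)))).subset fun t ht => ?_
      have h := ht.2
      rw [inner_add_left, real_inner_smul_left, real_inner_self_eq_norm_sq, hbr] at h
      simp only [Set.mem_ofPred_eq]
      linarith
    · obtain ⟨v, hvW, hv, hrv⟩ := exists_ne_zero_inner_eq_zero hW r
      refine ⟨v, hv, fun a => ?_⟩
      refine (finite_setOf_quartic_eq_zero
        (c₀ := ⟪a, r⟫ ^ 2 * B ^ 2 - ⟪b, r⟫ ^ 2 * ‖W.starProjection a‖ ^ 2)
        (c₁ := -(⟪b, r⟫ ^ 2 * (2 * ⟪a, v⟫))) (c₂ := -(⟪b, r⟫ ^ 2 * ‖v‖ ^ 2)) (c₃ := 0)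
        (c₄ := 0) (Or.inr (Or.inl (neg_ne_zero.2 (by positivity))))).subset fun t ht => ?_
      have h := ht.2
      rw [inner_add_left, real_inner_smul_left, real_inner_comm r v, hrv, hnorm v hvW] at h
      simp only [Set.mem_ofPred_eq]
      linarith
  · obtain ⟨v, hvW, hv, hbv⟩ := exists_ne_zero_inner_eq_zero hW (W.starProjection b)
    refine ⟨v, hv, fun a => ?_⟩
    set r := W.starProjection (ξ • a + w) with hr
    have hv' : W.starProjection v = v := Submodule.starProjection_eq_self_iff.2 hvW
    have hbv' : ⟪b, v⟫ = 0 := by rw [inner_eq_inner_starProjection hvW, hbv]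
    set α := ⟪a, r⟫
    set γ := ξ * ⟪a, v⟫ + ⟪v, r⟫ with hγ
    refine (finite_setOf_quartic_eq_zero
      (c₀ := α ^ 2 * B ^ 2 - ⟪b, r⟫ ^ 2 * ‖W.starProjection a‖ ^ 2)
      (c₁ := 2 * α * γ * B ^ 2 - ⟪b, r⟫ ^ 2 * (2 * ⟪a, v⟫))
      (c₂ := (γ ^ 2 + 2 * α * (ξ * ‖v‖ ^ 2)) * B ^ 2 - ⟪b, r⟫ ^ 2 * ‖v‖ ^ 2)
      (c₃ := 2 * γ * (ξ * ‖v‖ ^ 2) * B ^ 2)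
      (c₄ := (ξ * ‖v‖ ^ 2) ^ 2 * B ^ 2)
      (Or.inr (Or.inr (by positivity)))).subset fun t ht => ?_
    have h := ht.2
    have e : W.starProjection (ξ • (a + t • v) + w) = r + (ξ * t) • v := by
      rw [hr, show ξ • (a + t • v) + w = (ξ • a + w) + (ξ * t) • v by
        rw [smul_add, smul_smul]; abel, map_add, map_smul, hv']
    have e1 : ⟪a + t • v, r + (ξ * t) • v⟫ = α + γ * t + ξ * ‖v‖ ^ 2 * t ^ 2 := by
      rw [inner_add_left, inner_add_right, inner_add_right]
      simp only [real_inner_smul_left, real_inner_smul_right, real_inner_self_eq_norm_sq]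
      rw [hγ]
      ring
    have e2 : ⟪b, r + (ξ * t) • v⟫ = ⟪b, r⟫ := by
      rw [inner_add_right, real_inner_smul_right, hbv', mul_zero, add_zero]
    rw [e, e1, e2, hnorm v hvW] at h
    simp only [Set.mem_ofPred_eq]
    linear_combination h

lemma le_finrank_orthogonal_span {ι : Type*} (c : ι → E) (S : Finset ι) :
    Module.finrank ℝ E ≤ Module.finrank ℝ (Submodule.span ℝ (c '' S))ᗮ + S.card := by
  classical
  have h1 := Submodule.finrank_add_finrank_orthogonal (Submodule.span ℝ (c '' S))
  have h2 : Module.finrank ℝ (Submodule.span ℝ (c '' S)) ≤ S.card := by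
    have := finrank_span_finset_le_card (R := ℝ) (S.image c)
    rw [Finset.coe_image] at this
    exact this.trans Finset.card_image_le
  omega

end GeneralPosition

section Measurability

variable {E : Type*} [NormedAddCommGroup E] [InnerProductSpace ℝ E] [FiniteDimensional ℝ E]
  [MeasurableSpace E] [BorelSpace E] {ι : Type*} {Z : Type*} [MeasurableSpace Z]
  {c : Z → ι → E}

lemma measurable_res (hc : Measurable c) (S : Finset ι) {w : Z → E} (hw : Measurable w) :
    Measurable fun z => res (c z) S (w z) := by
  classical
  induction S using Finset.induction_on generalizing w with
  | empty => simpa using hw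
  | insert s S hs ih =>
    simp only [res_insert]
    have h1 := ih hw
    have h2 := ih (w := fun z => c z s) (by fun_prop)
    fun_prop

lemma measurable_score (hc : Measurable c) (S : Finset ι) (j : ι) {y : Z → E} (hy : Measurable y) :
    Measurable fun z => score (c z) (y z) S j := by
  have h1 := measurable_res hc S hy
  have h2 := measurable_res hc S (w := fun z => c z j) (by fun_prop)
  unfold score
  fun_prop

variable [Fintype ι]

lemma measurable_run [DecidableEq ι] (hc : Measurable c) {y : Z → E} (hy : Measurable y) (L : ℕ) (J : Finset ι) :
    ∀ (i : ℕ) (S : Finset ι), Measurable fun z => Run (c z) (y z) L J i S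
  | 0, S => measurable_const
  | i + 1, S' => by
    have h1 : ∀ S, Measurable fun z => res (c z) S (y z) ≠ 0 := fun S =>
      ((measurable_res hc S hy).eq measurable_const).not
    have h2 : ∀ S a b, Measurable fun z => score (c z) (y z) S a ≤ score (c z) (y z) S b :=
      fun S a b => measurableSet_setOfPred.1
        (measurableSet_le (measurable_score hc S a hy) (measurable_score hc S b hy))
    have h3 := measurable_run hc hy L J i
    unfold Run IsTop
    fun_prop

lemma measurable_generic (hc : Measurable c) {y : Z → E} (hy : Measurable y) (N : ℕ) :
    Measurable fun z => Generic (c z) (y z) N := by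
  have h1 : ∀ S, Measurable fun z => res (c z) S (y z) ≠ 0 := fun S =>
    ((measurable_res hc S hy).eq measurable_const).not
  have h2 : ∀ S a, Measurable fun z => res (c z) S (c z a) ≠ 0 := fun S a =>
    ((measurable_res hc S (w := fun z => c z a) (by fun_prop)).eq measurable_const).not
  have h3 : ∀ S a, Measurable fun z => ⟪c z a, res (c z) S (y z)⟫ ≠ 0 := fun S a =>
    (Measurable.eq ((by fun_prop : Measurable fun z => c z a).inner (measurable_res hc S hy))
      measurable_const).not
  have h4 : ∀ S a b, Measurable fun z => score (c z) (y z) S a ≠ score (c z) (y z) S b :=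
    fun S a b => ((measurable_score hc S a hy).eq (measurable_score hc S b hy)).not
  unfold Generic
  fun_prop

end Measurability

/-! ### Estimates for random columns -/

section Update

variable {E : Type*} [NormedAddCommGroup E] [InnerProductSpace ℝ E] {ι : Type*} [DecidableEq ι]

lemma res_update [FiniteDimensional ℝ E] {c : ι → E} {S : Finset ι} {j : ι} (hj : j ∉ S) (a : E) :
    res (Function.update c j a) S = res c S :=
  res_congr fun l hl => Function.update_of_ne (fun e => hj (by rwa [← e])) _ _

lemma res_piecewise_compl [FiniteDimensional ℝ E] [Fintype ι] (c c' : ι → E) (S : Finset ι) :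
    res (Sᶜ.piecewise c' c) S = res c S :=
  res_congr fun l hl => Finset.piecewise_eq_of_notMem _ _ _ (by simpa using hl)

lemma sum_update [Fintype ι] (c : ι → E) (x : ι → ℝ) (j : ι) (a ν : E) :
    ∑ l, x l • Function.update c j a l + ν =
      x j • a + (∑ l ∈ Finset.univ.erase j, x l • c l + ν) := by
  rw [← Finset.add_sum_erase _ _ (Finset.mem_univ j), Function.update_self, add_assoc]
  congr 2
  exact Finset.sum_congr rfl fun l hl => by rw [Function.update_of_ne (Finset.ne_of_mem_erase hl)]

end Update

lemma measurable_sum_smul_add {E : Type*} [NormedAddCommGroup E] [InnerProductSpace ℝ E]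
    [FiniteDimensional ℝ E] [MeasurableSpace E] [BorelSpace E] {ι : Type*} [Fintype ι] (x : ι → ℝ) (ν : E) :
    Measurable fun c : ι → E => ∑ j, x j • c j + ν := by
  fun_prop

section Probability

variable {E : Type*} [NormedAddCommGroup E] [InnerProductSpace ℝ E] [FiniteDimensional ℝ E]
  [MeasurableSpace E] [BorelSpace E] {ι : Type*} [Fintype ι]

variable (E ι) in
/-- The law of a family of independent Gaussian vectors with the law `colLaw E s`. -/
noncomputable def matLaw (s : ℝ) : Measure (ι → E) := Measure.pi fun _ => colLaw E s

instance (s : ℝ) : IsProbabilityMeasure (matLaw E ι s) :=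
  inferInstanceAs (IsProbabilityMeasure (Measure.pi fun _ => colLaw E s))

lemma matLaw_norm_gt {n : ℕ} (hn : Module.finrank ℝ E = n) (hn0 : 0 < n) (j : ι) :
    (matLaw E ι (√n)⁻¹).real {c | 2 < ‖c j‖} ≤ Real.exp (-(1 / 2 * n)) := by
  subst hn
  set n := Module.finrank ℝ E
  have hn' : 0 < √(n : ℝ) := Real.sqrt_pos.2 (by exact_mod_cast hn0)
  have hB : MeasurableSet {a : E | 2 < ‖a‖} := measurableSet_lt measurable_const measurable_norm
  have h1 : (matLaw E ι (√n)⁻¹) {c | 2 < ‖c j‖} = stdGaussian E {g | 2 < ‖(√n)⁻¹ • g‖} := by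
    refine Eq.trans ?_ (colLaw_apply (√n)⁻¹ hB)
    exact (measurePreserving_eval (fun _ : ι => colLaw E (√n)⁻¹) j).measure_preimage
      hB.nullMeasurableSet
  rw [measureReal_def, h1, ← measureReal_def]
  refine le_trans (measureReal_mono fun g hg => ?_) stdGaussian_le_norm_exp
  simp only [Set.mem_ofPred_eq, norm_smul, norm_inv, Real.norm_eq_abs, abs_of_pos hn'] at hg ⊢
  rw [lt_inv_mul_iff₀ hn'] at hg
  linarith

variable [DecidableEq ι]

/-- A property of the columns holds almost surely if it fails only at finitely many points of every
line on which the column `j` moves in a direction that may depend on the other columns. -/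
lemma ae_matLaw_of_line {s : ℝ} (hs : s ≠ 0) {Q : (ι → E) → Prop} (hQ : Measurable Q) (j : ι)
    (h : ∀ c, ∃ v : E, v ≠ 0 ∧ ∀ a, {t : ℝ | ¬ Q (Function.update c j (a + t • v))}.Finite) :
    ∀ᵐ c ∂matLaw E ι s, Q c := by
  have hB : MeasurableSet {c | ¬ Q c} := measurableSet_setOfPred.2 hQ.not
  rw [ae_iff, matLaw, pi_eq_lintegral_update _ j hB]
  refine (lintegral_congr fun c => ?_).trans lintegral_zero
  obtain ⟨v, hv, hf⟩ := h c
  exact colLaw_eq_zero_of_finite hs (measurable_update c hB) hv hf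

/-- Gaussian columns are almost surely in general position. -/
theorem ae_generic {s : ℝ} (hs : s ≠ 0) (x : ι → ℝ) (ν : E) {N : ℕ}
    (hN : N + 2 ≤ Module.finrank ℝ E) :
    ∀ᵐ c ∂matLaw E ι s, Generic c (∑ j, x j • c j + ν) N := by
  have hy := measurable_sum_smul_add x ν
  have hW : ∀ (c : ι → E) (S : Finset ι), S.card ≤ N →
      2 ≤ Module.finrank ℝ (Submodule.span ℝ (c '' S))ᗮ := fun c S hS => by
    have := le_finrank_orthogonal_span c S
    omega
  have h1 : ∀ S : Finset ι, S.card ≤ N → ∀ a ∉ S, ∀ᵐ c ∂matLaw E ι s, res c S (c a) ≠ 0 := by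
    intro S hS a ha
    refine ae_matLaw_of_line hs ?_ a fun c => ?_
    · exact ((measurable_res measurable_id S (measurable_pi_apply a)).eq measurable_const).not
    obtain ⟨v, hvW, hv, -⟩ := exists_ne_zero_inner_eq_zero (hW c S hS) 0
    refine ⟨v, hv, fun b => Set.Subsingleton.finite fun t ht t' ht' => ?_⟩
    simp only [Set.mem_ofPred_eq, not_not, res_update ha, Function.update_self, map_add, map_smul,
      res_eq_self hvW] at ht ht'
    have : (t - t') • v = 0 := by
      rw [sub_smul, ← sub_eq_zero.2 (ht.trans ht'.symm)]; abel
    exact sub_eq_zero.1 ((smul_eq_zero.1 this).resolve_right hv)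
  have h2 : ∀ S : Finset ι, S.card ≤ N → ∀ a ∉ S, ∀ᵐ c ∂matLaw E ι s,
      res c S (∑ j, x j • c j + ν) ≠ 0 → ⟪c a, res c S (∑ j, x j • c j + ν)⟫ ≠ 0 := by
    intro S hS a ha
    have hr := measurable_res (measurable_id (α := ι → E)) S hy
    refine ae_matLaw_of_line hs ?_ a fun c => ?_
    · exact (hr.eq measurable_const).not.imp
        (Measurable.eq ((measurable_pi_apply a).inner hr) measurable_const).not
    obtain ⟨v, hv, hf⟩ := exists_line_inner (hW c S hS) (x a)
      (∑ l ∈ Finset.univ.erase a, x l • c l + ν)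
    refine ⟨v, hv, fun b => (hf b).subset fun t ht => ?_⟩
    simp only [Set.mem_ofPred_eq, Classical.not_imp, not_not, res_update ha, sum_update,
      Function.update_self] at ht
    exact ht
  have h3 : ∀ S : Finset ι, S.card ≤ N → ∀ a ∉ S, ∀ b, b ≠ a → ∀ᵐ c ∂matLaw E ι s,
      res c S (c a) ≠ 0 ∧ res c S (c b) ≠ 0 ∧ res c S (∑ j, x j • c j + ν) ≠ 0 →
        score c (∑ j, x j • c j + ν) S a ≠ score c (∑ j, x j • c j + ν) S b := by
    intro S hS a ha b hb
    have hr := measurable_res (measurable_id (α := ι → E)) S hy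
    have hra := measurable_res (measurable_id (α := ι → E)) S (measurable_pi_apply a)
    have hrb := measurable_res (measurable_id (α := ι → E)) S (measurable_pi_apply b)
    refine ae_matLaw_of_line hs ?_ a fun c => ?_
    · exact ((hra.eq measurable_const).not.and ((hrb.eq measurable_const).not.and
        (hr.eq measurable_const).not)).imp
        ((measurable_score measurable_id S a hy).eq (measurable_score measurable_id S b hy)).not
    by_cases hcb : res c S (c b) = 0
    · obtain ⟨v, -, hv, -⟩ := exists_ne_zero_inner_eq_zero (hW c S hS) 0
      refine ⟨v, hv, fun d => ?_⟩
      simp [res_update ha, Function.update_of_ne hb, hcb]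
    obtain ⟨v, hv, hf⟩ := exists_line_score (hW c S hS) (x a)
      (∑ l ∈ Finset.univ.erase a, x l • c l + ν) (b := c b) hcb
    refine ⟨v, hv, fun d => (hf d).subset fun t ht => ?_⟩
    simp only [Set.mem_ofPred_eq, Classical.not_imp, not_not, res_update ha, sum_update,
      Function.update_self, Function.update_of_ne hb, score] at ht
    obtain ⟨⟨h0, -, h1⟩, h2⟩ := ht
    refine ⟨h1, ?_⟩
    rw [div_eq_div_iff (norm_ne_zero_iff.2 h0) (norm_ne_zero_iff.2 hcb)] at h2
    have := congrArg (· ^ 2) h2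
    simp only [mul_pow, sq_abs] at this
    exact this
  have h1' : ∀ᵐ c ∂matLaw E ι s, ∀ S : Finset ι, S.card ≤ N → ∀ a ∉ S, res c S (c a) ≠ 0 := by
    simp only [ae_all_iff]; exact h1
  have h2' : ∀ᵐ c ∂matLaw E ι s, ∀ S : Finset ι, S.card ≤ N → ∀ a ∉ S,
      res c S (∑ j, x j • c j + ν) ≠ 0 → ⟪c a, res c S (∑ j, x j • c j + ν)⟫ ≠ 0 := by
    simp only [ae_all_iff (ι := Finset ι), ae_all_iff (ι := ι), Filter.eventually_imp_distrib_left]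
    exact h2
  have h3' : ∀ᵐ c ∂matLaw E ι s, ∀ S : Finset ι, S.card ≤ N → ∀ a ∉ S, ∀ b, b ≠ a →
      res c S (c a) ≠ 0 ∧ res c S (c b) ≠ 0 ∧ res c S (∑ j, x j • c j + ν) ≠ 0 →
        score c (∑ j, x j • c j + ν) S a ≠ score c (∑ j, x j • c j + ν) S b := by
    simp only [ae_all_iff (ι := Finset ι), ae_all_iff (ι := ι), Filter.eventually_imp_distrib_left]
    exact h3
  filter_upwards [h1', h2', h3'] with c g1 g2 g3 S hS a ha
  exact ⟨g1 S hS a ha, fun h0 => ⟨g2 S hS a ha h0, fun b hb hba =>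
    g3 S hS a ha b hba ⟨g1 S hS a ha, g1 S hS b hb, h0⟩⟩⟩

/-- A combination of columns is not shrunk much by the projection that belongs to a small set of
other columns. -/
lemma matLaw_norm_res_lt {δ : ℝ} (hδ : 0 < δ) (hδ1 : δ < 1) {n : ℕ}
    (hn : Module.finrank ℝ E = n) (hn0 : 0 < n) {S : Finset ι} (hS : S.card ≤ δ / 4 * n)
    (v : ι → ℝ) (hv : ∀ j ∈ S, v j = 0) :
    (matLaw E ι (√n)⁻¹).real {c | ‖res c S (∑ j, v j • c j)‖ < (1 - δ) * √(∑ j, v j ^ 2)} ≤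
      Real.exp (-(δ ^ 2 / 8 * n)) := by
  set Q := √(∑ j, v j ^ 2) with hQ
  by_cases hQ0 : Q = 0
  · have : {c : ι → E | ‖res c S (∑ j, v j • c j)‖ < (1 - δ) * Q} = ∅ := by
      ext c; simp [hQ0]
    rw [this, measureReal_empty]
    positivity
  have hQpos : 0 < Q := lt_of_le_of_ne (Real.sqrt_nonneg _) (Ne.symm hQ0)
  have hn' : 0 < √(n : ℝ) := Real.sqrt_pos.2 (by exact_mod_cast hn0)
  have hsum : Measurable fun c : ι → E => ∑ j, v j • c j := by fun_prop
  have hB : MeasurableSet {c : ι → E | ‖res c S (∑ j, v j • c j)‖ < (1 - δ) * Q} :=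
    measurableSet_lt (measurable_res measurable_id S hsum).norm measurable_const
  refine ENNReal.toReal_le_of_le_ofReal (Real.exp_pos _).le ?_
  rw [matLaw, pi_eq_lintegral_piecewise _ Sᶜ hB]
  have key : ∀ c : ι → E, (Measure.pi fun _ : ι => colLaw E (√n)⁻¹)
      {c' | Sᶜ.piecewise c' c ∈ {c : ι → E | ‖res c S (∑ j, v j • c j)‖ < (1 - δ) * Q}} ≤
      ENNReal.ofReal (Real.exp (-(δ ^ 2 / 8 * n))) := by
    intro c
    set W := (Submodule.span ℝ (c '' S))ᗮ
    have hset : {c' | Sᶜ.piecewise c' c ∈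
        {c : ι → E | ‖res c S (∑ j, v j • c j)‖ < (1 - δ) * Q}} =
        (fun c' : ι → E => ∑ j, v j • c' j) ⁻¹' {z | ‖res c S z‖ < (1 - δ) * Q} := by
      ext c'
      simp only [Set.mem_ofPred_eq, Set.mem_preimage, res_piecewise_compl]
      have : ∑ j, v j • Sᶜ.piecewise c' c j = ∑ j, v j • c' j := by
        refine Finset.sum_congr rfl fun j _ => ?_
        by_cases hj : j ∈ S
        · simp [hv j hj]
        · rw [Finset.piecewise_eq_of_mem _ _ _ (by simpa using hj)]
      rw [this]
    have hB1 : MeasurableSet {z : E | ‖res c S z‖ < (1 - δ) * Q} :=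
      measurableSet_lt (res c S).measurable.norm measurable_const
    rw [hset, ← Measure.map_apply hsum hB1, map_sum_smul_pi_colLaw, colLaw_apply _ hB1]
    have hsub : {g : E | (((√n)⁻¹ * √(∑ j, v j ^ 2)) • g) ∈
        {z : E | ‖res c S z‖ < (1 - δ) * Q}} ⊆
        W.orthogonalProjectionOnto ⁻¹' {g | ‖g‖ ≤ (1 - δ) * √n} := by
      intro g hg
      simp only [Set.mem_ofPred_eq, map_smul, norm_smul, ← hQ, norm_mul, norm_inv,
        Real.norm_eq_abs, abs_of_pos hQpos, abs_of_pos hn'] at hg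
      simp only [Set.mem_preimage, Set.mem_ofPred_eq]
      have e : ‖res c S g‖ = ‖W.orthogonalProjectionOnto g‖ := rfl
      rw [e] at hg
      have h2 : ((√n)⁻¹ * ‖W.orthogonalProjectionOnto g‖) * Q < (1 - δ) * Q := by linarith
      have h3 := lt_of_mul_lt_mul_right h2 hQpos.le
      rw [inv_mul_lt_iff₀ hn'] at h3
      linarith
    refine (measure_mono hsub).trans ?_
    rw [← Measure.map_apply (by fun_prop) (measurableSet_le (by fun_prop) (by fun_prop)),
      map_orthogonalProjectionOnto_stdGaussian, ← ofReal_measureReal]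
    apply ENNReal.ofReal_le_ofReal
    refine stdGaussian_norm_le_exp hδ hδ1 ?_
    have h4 := le_finrank_orthogonal_span c S
    rw [hn] at h4
    have h5 : (n : ℝ) ≤ Module.finrank ℝ W + S.card := by exact_mod_cast h4
    linarith
  refine (lintegral_mono key).trans ?_
  simp

/-- The leave-one-out estimate: the residual of a run in which the column `j` does not compete
is independent of that column. -/
lemma matLaw_incoherent {n : ℕ} (hn : Module.finrank ℝ E = n) (hn0 : 0 < n) {x : ι → ℝ} (ν : E)
    {k L i N : ℕ} (hN : N + 2 ≤ n) (hi : (i - 1) * L ≤ N) (hk : 0 < k)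
    {c₀ : ℝ} (hc₀ : 0 ≤ c₀) {j : ι} (hj : x j = 0) :
    (matLaw E ι (√n)⁻¹).real {c | ∃ S, Run c (∑ l, x l • c l + ν) L (Finset.univ.erase j) i S ∧
      c₀ * ‖res c S (∑ l, x l • c l + ν)‖ / √k < |⟪c j, res c S (∑ l, x l • c l + ν)⟫|} ≤
      2 * Real.exp (-(c₀ ^ 2 / 2 * (n / k))) := by
  have hn' : 0 < √(n : ℝ) := Real.sqrt_pos.2 (by exact_mod_cast hn0)
  have hk' : 0 < √(k : ℝ) := Real.sqrt_pos.2 (by exact_mod_cast hk)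
  set P := matLaw E ι (√n)⁻¹ with hP
  set p := 2 * Real.exp (-(c₀ ^ 2 / 2 * (n / k))) with hp
  let y : (ι → E) → E := fun c => ∑ l, x l • c l + ν
  have hy : Measurable y := measurable_sum_smul_add x ν
  let R : Finset ι → Set (ι → E) := fun S => {c | Run c (y c) L (Finset.univ.erase j) i S}
  let D : Finset ι → Set (ι → E) := fun S =>
    {c | c₀ * ‖res c S (y c)‖ / √k < |⟪c j, res c S (y c)⟫|}
  have hR : ∀ S, MeasurableSet (R S) := fun S =>
    measurableSet_setOfPred.2 (measurable_run measurable_id hy L _ i S)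
  have hD : ∀ S, MeasurableSet (D S) := fun S => by
    have hr := measurable_res (measurable_id (α := ι → E)) S hy
    exact measurableSet_lt ((hr.norm.const_mul _).div_const _)
      ((measurable_pi_apply j).inner hr).abs
  have hset : {c | ∃ S, Run c (y c) L (Finset.univ.erase j) i S ∧
      c₀ * ‖res c S (y c)‖ / √k < |⟪c j, res c S (y c)⟫|} = ⋃ S, R S ∩ D S := by
    ext c; simp [R, D]
  -- The column `j` is fresh given the event `R S`.
  have hone : ∀ S, P (R S ∩ D S) ≤ ENNReal.ofReal p * P (R S) := by
    intro S
    by_cases hjS : j ∈ S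
    · have : R S = ∅ := by
        ext c
        simp only [R, Set.mem_ofPred_eq, Set.mem_empty_iff_false, iff_false]
        intro h
        exact Finset.notMem_erase j _ (h.subset hjS)
      simp [this]
    rw [hP, matLaw, pi_eq_lintegral_update _ j ((hR S).inter (hD S)),
      pi_eq_lintegral_update _ j (hR S), ← lintegral_const_mul']
    swap
    · exact ENNReal.ofReal_ne_top
    refine lintegral_mono fun c => ?_
    have hyu : ∀ a, y (Function.update c j a) = y c := by
      intro a
      have := sum_update c x j (c j) ν
      rw [Function.update_eq_self] at this
      simp only [y]
      rw [sum_update, this, hj, zero_smul, zero_smul]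
    have hRu : ∀ a, Function.update c j a ∈ R S ↔ c ∈ R S := by
      intro a
      have hc : ∀ l ∈ Finset.univ.erase j, Function.update c j a l = c l := fun l hl =>
        Function.update_of_ne (Finset.ne_of_mem_erase hl) _ _
      simp only [R, Set.mem_ofPred_eq, hyu]
      exact ⟨fun h => h.congr hc, fun h => h.congr fun l hl => (hc l hl).symm⟩
    by_cases hcR : c ∈ R S
    · simp only [Set.mem_inter_iff, hRu, hcR, true_and]
      simp only [D, Set.mem_ofPred_eq, hyu, res_update hjS, Function.update_self]
      set r := res c S (y c)
      have hBr : MeasurableSet {a : E | c₀ * ‖r‖ / √k < |⟪a, r⟫|} :=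
        measurableSet_lt measurable_const (by fun_prop)
      rw [colLaw_apply _ hBr]
      simp only [Set.ofPred_true, measure_univ, mul_one]
      rw [← ofReal_measureReal]
      apply ENNReal.ofReal_le_ofReal
      have h1 := stdGaussian_abs_inner_gt (a := c₀ * √n / √k) (by positivity) r
      have h2 : (c₀ * √n / √k) ^ 2 / 2 = c₀ ^ 2 / 2 * (n / k) := by
        rw [div_pow, mul_pow, Real.sq_sqrt (Nat.cast_nonneg n), Real.sq_sqrt (Nat.cast_nonneg k)]
        ring
      rw [h2] at h1
      refine le_trans (measureReal_mono fun g hg => ?_) h1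
      simp only [Set.mem_ofPred_eq, real_inner_smul_left, abs_mul, abs_inv, abs_of_pos hn'] at hg ⊢
      rw [lt_inv_mul_iff₀ hn'] at hg
      calc _ = √n * (c₀ * ‖r‖ / √k) := by ring
        _ < _ := hg
    · simp [hRu, hcR]
  -- The events `R S` are almost surely disjoint.
  have hdisj : ∑ S, P (R S) ≤ 1 := by
    have hae := ae_generic (ι := ι) (inv_ne_zero hn'.ne') x ν (N := N) (by rw [hn]; exact hN)
    have hpair : Set.Pairwise (↑(Finset.univ : Finset (Finset ι))) (Function.onFun (AEDisjoint P) R) := by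
      intro S _ S' _ hne
      refine measure_mono_null (fun c hc => ?_) (ae_iff.1 hae)
      intro hg
      exact hne (Run.unique hg hi hc.1 hc.2)
    rw [← measure_biUnion_finset₀ hpair fun S _ => (hR S).nullMeasurableSet]
    exact prob_le_one
  refine ENNReal.toReal_le_of_le_ofReal (by positivity) ?_
  rw [hset]
  calc P (⋃ S, R S ∩ D S) ≤ ∑ S, P (R S ∩ D S) := measure_iUnion_fintype_le _ _
    _ ≤ ∑ S, ENNReal.ofReal p * P (R S) := Finset.sum_le_sum fun S _ => hone S
    _ = ENNReal.ofReal p * ∑ S, P (R S) := (Finset.mul_sum _ _ _).symm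
    _ ≤ ENNReal.ofReal p * 1 := by gcongr
    _ = _ := mul_one _

end Probability

/-! ### Union bound and laws of the random data -/

section UnionBound

variable {n m : ℕ}

lemma measurable_good {Z : Type*} [MeasurableSpace Z]
    {c : Z → Fin m → EuclideanSpace ℝ (Fin n)} (hc : Measurable c)
    {y : Z → EuclideanSpace ℝ (Fin n)} (hy : Measurable y) (x : Fin m → ℝ) (k L : ℕ) (κ c₀ : ℝ) :
    Measurable fun z => Good (c z) x (y z) k L κ c₀ := by
  have hiff : ∀ z, Good (c z) x (y z) k L κ c₀ ↔ Generic (c z) (y z) (k * L) ∧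
      (∀ S : Finset (Fin m), S.card ≤ k * L →
        κ * √(∑ j ∈ Sᶜ, x j ^ 2) ≤ ‖res (c z) S (∑ j ∈ Sᶜ, x j • c z j)‖) ∧
      (∀ S : Finset (Fin m), S.card ≤ k * L → ∀ j, j ∉ S → 1 / 2 ≤ ‖res (c z) S (c z j)‖) ∧
      (∀ j, ‖c z j‖ ≤ 2) ∧
      (∀ j, x j = 0 → ∀ i, i < k → ∀ S, Run (c z) (y z) L (Finset.univ.erase j) i S →
        |⟪c z j, res (c z) S (y z)⟫| ≤ c₀ * ‖res (c z) S (y z)‖ / √k) := fun z =>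
    ⟨fun h => ⟨h.1, h.2, h.3, h.4, h.5⟩, fun ⟨h1, h2, h3, h4, h5⟩ => ⟨h1, h2, h3, h4, h5⟩⟩
  simp only [hiff]
  have hcj : ∀ j, Measurable fun z => c z j := fun j => by fun_prop
  have h1 := measurable_generic hc hy (k * L)
  have h2 : ∀ S : Finset (Fin m), Measurable fun z =>
      κ * √(∑ j ∈ Sᶜ, x j ^ 2) ≤ ‖res (c z) S (∑ j ∈ Sᶜ, x j • c z j)‖ := fun S =>
    measurableSet_setOfPred.1 (measurableSet_le measurable_const
      (measurable_res hc S (by fun_prop)).norm)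
  have h3 : ∀ (S : Finset (Fin m)) j, Measurable fun z => 1 / 2 ≤ ‖res (c z) S (c z j)‖ :=
    fun S j => measurableSet_setOfPred.1 (measurableSet_le measurable_const
      (measurable_res hc S (hcj j)).norm)
  have h4 : ∀ j, Measurable fun z => ‖c z j‖ ≤ 2 := fun j =>
    measurableSet_setOfPred.1 (measurableSet_le (hcj j).norm measurable_const)
  have h5 : ∀ (S : Finset (Fin m)) j, Measurable fun z =>
      |⟪c z j, res (c z) S (y z)⟫| ≤ c₀ * ‖res (c z) S (y z)‖ / √k := fun S j =>
    have hr := measurable_res hc S hy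
    measurableSet_setOfPred.1 (measurableSet_le ((hcj j).inner hr).abs
      ((hr.norm.const_mul _).div_const _))
  have h6 : ∀ j i S, Measurable fun z => Run (c z) (y z) L (Finset.univ.erase j) i S :=
    fun j i S => measurable_run hc hy L _ i S
  fun_prop

lemma card_filter_card_le {d : ℕ} (hd : d + 1 ≤ m) :
    (Finset.univ.filter fun S : Finset (Fin m) => S.card ≤ d).card ≤ m ^ (d + 1) := by
  have hsub : (Finset.univ.filter fun S : Finset (Fin m) => S.card ≤ d) ⊆
      (Finset.range (d + 1)).biUnion fun i => Finset.powersetCard i Finset.univ := by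
    intro S hS
    simp only [Finset.mem_filter, Finset.mem_univ, true_and] at hS
    simp only [Finset.mem_biUnion, Finset.mem_range, Finset.mem_powersetCard]
    exact ⟨S.card, by omega, Finset.subset_univ _, rfl⟩
  calc _ ≤ _ := Finset.card_le_card hsub
    _ ≤ ∑ i ∈ Finset.range (d + 1), (Finset.powersetCard i (Finset.univ : Finset (Fin m))).card :=
      Finset.card_biUnion_le
    _ ≤ ∑ _i ∈ Finset.range (d + 1), m ^ d := by
      refine Finset.sum_le_sum fun i hi => ?_
      rw [Finset.card_powersetCard, Finset.card_univ, Fintype.card_fin]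
      exact (Nat.choose_le_pow _ _).trans
        (Nat.pow_le_pow_right (by omega) (by simp at hi; omega))
    _ = (d + 1) * m ^ d := by simp
    _ ≤ m * m ^ d := Nat.mul_le_mul_right _ hd
    _ = _ := by rw [pow_succ, mul_comm]

lemma measureReal_biUnion_le_of_forall {α ι : Type*} [MeasurableSpace α] (μ : Measure α)
    (s : Finset ι) (B : ι → Set α) {p : ℝ} (h : ∀ i ∈ s, μ.real (B i) ≤ p) :
    μ.real (⋃ i ∈ s, B i) ≤ s.card * p := by
  refine (measureReal_biUnion_finset_le s B).trans ?_
  simpa using Finset.sum_le_card_nsmul s _ p h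

/-- The union bound for the complement of the event `Good`, for a fixed value of the noise. -/
lemma matLaw_not_good_le {k L : ℕ} {δ c₀ β : ℝ} (hδ : 0 < δ) (hδ2 : δ ≤ 1 / 2) (hc₀ : 0 ≤ c₀)
    (hk : 0 < k) (hkn : k < n) (hnm : n < m) (hkL : (k * L : ℕ) ≤ δ / 4 * n) (hkLn : k * L + 2 ≤ n)
    (hq : Real.exp (-(δ ^ 2 / 8 * n)) ≤ β ^ 2 / (m : ℝ) ^ (k * L + 5))
    (hp : Real.exp (-(c₀ ^ 2 / 2 * (n / k))) ≤ β ^ 2 / (m : ℝ) ^ 5)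
    (x : Fin m → ℝ) (ν : EuclideanSpace ℝ (Fin n)) :
    (matLaw (EuclideanSpace ℝ (Fin n)) (Fin m) (√n)⁻¹).real
      {c | ¬ Good c x (∑ j, x j • c j + ν) k L (1 - δ) c₀} ≤ 5 * (β ^ 2 / (m : ℝ) ^ 3) := by
  let E := EuclideanSpace ℝ (Fin n)
  have hfin : Module.finrank ℝ E = n := by simp [E]
  have hn0 : 0 < n := by omega
  have hm0 : (0 : ℝ) < m := by exact_mod_cast (by omega : 0 < m)
  have hm1 : (1 : ℝ) ≤ m := by exact_mod_cast (by omega : 1 ≤ m)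
  have hnpos : (0 : ℝ) < n := by exact_mod_cast hn0
  set P := matLaw E (Fin m) (√n)⁻¹ with hP
  set q := Real.exp (-(δ ^ 2 / 8 * n)) with hqdef
  set p := 2 * Real.exp (-(c₀ ^ 2 / 2 * (n / k))) with hpdef
  set F := Finset.univ.filter fun S : Finset (Fin m) => S.card ≤ k * L with hF
  have hFcard : (F.card : ℝ) ≤ (m : ℝ) ^ (k * L + 1) := by
    exact_mod_cast card_filter_card_le (m := m) (d := k * L) (by omega)
  let y : (Fin m → E) → E := fun c => ∑ j, x j • c j + ν
  let B₁ : Finset (Fin m) → Set (Fin m → E) := fun S =>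
    {c | ‖res c S (∑ j ∈ Sᶜ, x j • c j)‖ < (1 - δ) * √(∑ j ∈ Sᶜ, x j ^ 2)}
  let B₂ : Finset (Fin m) × Fin m → Set (Fin m → E) := fun a =>
    {c | a.2 ∉ a.1 ∧ ‖res c a.1 (c a.2)‖ < 1 - δ}
  let B₃ : Fin m → Set (Fin m → E) := fun j => {c | 2 < ‖c j‖}
  let B₄ : Fin m × ℕ → Set (Fin m → E) := fun a =>
    {c | x a.1 = 0 ∧ ∃ S, Run c (y c) L (Finset.univ.erase a.1) a.2 S ∧
      c₀ * ‖res c S (y c)‖ / √k < |⟪c a.1, res c S (y c)⟫|}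
  have hsub : {c | ¬ Good c x (y c) k L (1 - δ) c₀} ⊆ {c | ¬ Generic c (y c) (k * L)} ∪
      ((⋃ S ∈ F, B₁ S) ∪ ((⋃ a ∈ F ×ˢ Finset.univ, B₂ a) ∪ ((⋃ j ∈ Finset.univ, B₃ j) ∪
        ⋃ a ∈ Finset.univ ×ˢ Finset.range k, B₄ a))) := by
    intro c hc
    by_contra hno
    simp only [Set.mem_union, not_or, Set.mem_iUnion, not_exists] at hno
    obtain ⟨h0, h1, h2, h3, h4⟩ := hno
    refine hc ⟨not_not.1 h0, fun S hS => ?_, fun S hS j hj => ?_, fun j => ?_,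
      fun j hj i hi S hS => ?_⟩
    · exact not_lt.1 (h1 S (by simpa [hF] using hS))
    · exact (by linarith : (1 : ℝ) / 2 ≤ 1 - δ).trans
        (not_lt.1 fun h => h2 (S, j) (by simpa [hF] using hS) ⟨hj, h⟩)
    · exact not_lt.1 (h3 j (by simp))
    · exact not_lt.1 fun h => h4 (j, i) (by simpa using hi) ⟨hj, S, hS, h⟩
  have hcardS : ∀ S ∈ F, (S.card : ℝ) ≤ δ / 4 * n := by
    intro S hS
    refine le_trans ?_ hkL
    exact_mod_cast (Finset.mem_filter.1 hS).2
  have hb0 : P.real {c | ¬ Generic c (y c) (k * L)} = 0 := by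
    rw [measureReal_def, ae_iff.1 (ae_generic (ι := Fin m) (by positivity) x ν
      (by rw [hfin]; exact hkLn)), ENNReal.toReal_zero]
  have hb1 : P.real (⋃ S ∈ F, B₁ S) ≤ F.card * q := by
    refine measureReal_biUnion_le_of_forall _ _ _ fun S hS => ?_
    have h := matLaw_norm_res_lt hδ (by linarith) hfin hn0 (hcardS S hS)
      (fun j => if j ∈ S then 0 else x j) (fun j hj => if_pos hj)
    have e1 : ∀ c : Fin m → E, ∑ j, (if j ∈ S then 0 else x j) • c j = ∑ j ∈ Sᶜ, x j • c j := by
      intro c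
      rw [← Finset.sum_subset (Finset.subset_univ Sᶜ) (fun j _ hj => by simp_all)]
      exact Finset.sum_congr rfl fun j hj => by rw [if_neg (by simpa using hj)]
    have e2 : ∑ j, (if j ∈ S then 0 else x j) ^ 2 = ∑ j ∈ Sᶜ, x j ^ 2 := by
      rw [← Finset.sum_subset (Finset.subset_univ Sᶜ) (fun j _ hj => by simp_all)]
      exact Finset.sum_congr rfl fun j hj => by rw [if_neg (by simpa using hj)]
    simp only [e1, e2] at h
    exact h
  have hb2 : P.real (⋃ a ∈ F ×ˢ Finset.univ, B₂ a) ≤ (F ×ˢ Finset.univ (α := Fin m)).card * q := by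
    refine measureReal_biUnion_le_of_forall _ _ _ fun a ha => ?_
    by_cases haS : a.2 ∈ a.1
    · have : B₂ a = ∅ := by ext c; simp [B₂, haS]
      rw [this, measureReal_empty]
      exact (Real.exp_pos _).le
    have h := matLaw_norm_res_lt hδ (by linarith) hfin hn0 (hcardS a.1 (Finset.mem_product.1 ha).1)
      (Pi.single a.2 (1 : ℝ)) (fun j hj => Pi.single_eq_of_ne (fun e => haS (by rwa [← e])) _)
    have e1 : ∀ c : Fin m → E, ∑ j, (Pi.single a.2 (1 : ℝ) : Fin m → ℝ) j • c j = c a.2 := by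
      intro c
      rw [Finset.sum_eq_single a.2 (fun j _ hj => by rw [Pi.single_eq_of_ne hj, zero_smul])
        (by simp)]
      simp
    have e2 : ∑ j, (Pi.single a.2 (1 : ℝ) : Fin m → ℝ) j ^ 2 = 1 := by
      rw [Finset.sum_eq_single a.2 (fun j _ hj => by rw [Pi.single_eq_of_ne hj]; norm_num)
        (by simp)]
      simp
    simp only [e1, e2, Real.sqrt_one, mul_one] at h
    refine le_trans (measureReal_mono fun c hc => hc.2) h
  have hb3 : P.real (⋃ j ∈ Finset.univ, B₃ j) ≤ (Finset.univ (α := Fin m)).card * q := by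
    refine measureReal_biUnion_le_of_forall _ _ _ fun j _ => ?_
    refine (matLaw_norm_gt hfin hn0 j).trans (Real.exp_le_exp.2 ?_)
    have : δ ^ 2 / 8 ≤ 1 / 2 := by nlinarith
    nlinarith
  have hb4 : P.real (⋃ a ∈ Finset.univ ×ˢ Finset.range k, B₄ a) ≤
      (Finset.univ (α := Fin m) ×ˢ Finset.range k).card * p := by
    refine measureReal_biUnion_le_of_forall _ _ _ fun a ha => ?_
    by_cases hx : x a.1 = 0
    · have hi : a.2 < k := Finset.mem_range.1 (Finset.mem_product.1 ha).2
      refine le_trans (measureReal_mono fun c hc => hc.2) (matLaw_incoherent hfin hn0 ν hkLn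
        (Nat.mul_le_mul_right L (by omega : a.2 - 1 ≤ k)) hk hc₀ hx)
    · have : B₄ a = ∅ := by ext c; simp [B₄, hx]
      rw [this, measureReal_empty]
      positivity
  have htot := (measureReal_mono (μ := P) hsub).trans <| (measureReal_union_le _ _).trans <|
    add_le_add hb0.le <| (measureReal_union_le _ _).trans <|
    add_le_add hb1 <| (measureReal_union_le _ _).trans <| add_le_add hb2 <|
    (measureReal_union_le _ _).trans <| add_le_add hb3 hb4
  refine htot.trans ?_
  rw [Finset.card_product, Finset.card_product, Finset.card_univ, Fintype.card_fin,
    Finset.card_range]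
  push_cast
  have hq0 : 0 ≤ q := (Real.exp_pos _).le
  have hFm : (F.card : ℝ) * m * q ≤ β ^ 2 / (m : ℝ) ^ 3 := by
    calc (F.card : ℝ) * m * q ≤ (m : ℝ) ^ (k * L + 1) * m * (β ^ 2 / (m : ℝ) ^ (k * L + 5)) := by
          gcongr
      _ = β ^ 2 / (m : ℝ) ^ 3 := by
          rw [show k * L + 5 = (k * L + 1) + 1 + 3 by ring, pow_add _ (k * L + 1 + 1), pow_succ]
          field_simp
          ring
  have h1 : (F.card : ℝ) * q ≤ β ^ 2 / (m : ℝ) ^ 3 := by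
    refine le_trans ?_ hFm
    have : (0 : ℝ) ≤ F.card * q := by positivity
    nlinarith
  have h3 : (m : ℝ) * q ≤ β ^ 2 / (m : ℝ) ^ 3 := by
    refine le_trans ?_ hFm
    have hF1 : (1 : ℝ) ≤ F.card := by
      exact_mod_cast Finset.card_pos.2 ⟨∅, by simp [hF]⟩
    have : (0 : ℝ) ≤ m * q := by positivity
    nlinarith
  have h4 : (m : ℝ) * k * p ≤ 2 * (β ^ 2 / (m : ℝ) ^ 3) := by
    have hkm : (k : ℝ) ≤ m := by exact_mod_cast (by omega : k ≤ m)
    calc (m : ℝ) * k * p ≤ m * m * (2 * (β ^ 2 / (m : ℝ) ^ 5)) := by rw [hpdef]; gcongr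
      _ = _ := by field_simp
  linarith

end UnionBound

section Laws

variable {n m : ℕ}

lemma colLaw_euclideanSpace :
    colLaw (EuclideanSpace ℝ (Fin n)) (√n)⁻¹ =
      (Measure.pi fun _ : Fin n => gaussianReal 0 (1 / (n : ℝ≥0))).map (WithLp.toLp 2) := by
  have h1 : gaussianReal 0 (1 / (n : ℝ≥0)) = (gaussianReal 0 1).map ((√n)⁻¹ * ·) := by
    rw [gaussianReal_map_const_mul]
    congr 1
    · simp
    · ext
      simp
  have : ∀ _ : Fin n, SigmaFinite ((gaussianReal 0 1).map ((√n)⁻¹ * ·)) := fun _ => by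
    rw [← h1]; infer_instance
  rw [h1, ← Measure.pi_map_pi (fun _ => by fun_prop), Measure.map_map (by fun_prop) (by fun_prop),
    colLaw, ← map_pi_eq_stdGaussian, Measure.map_map (by fun_prop) (by fun_prop)]
  rfl

variable {Ω : Type*} [MeasurableSpace Ω] {μ : Measure Ω}
  {A : Ω → Matrix (Fin n) (Fin m) ℝ}

lemma IsGaussianMatrix.hasLaw_col (h : IsGaussianMatrix μ A) :
    HasLaw (fun ω => col (A ω)) (matLaw (EuclideanSpace ℝ (Fin n)) (Fin m) (√n)⁻¹) μ := by
  set N := gaussianReal 0 (1 / (n : ℝ≥0)) with hN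
  have h1 : HasLaw (fun ω (p : Fin m × Fin n) => A ω p.2 p.1) (Measure.pi fun _ => N) μ :=
    (h.2.precomp (g := Prod.swap) Prod.swap_injective).hasLaw_pi fun p => h.1 p.2 p.1
  have h2 : HasLaw (MeasurableEquiv.curry (Fin m) (Fin n) ℝ)
      (Measure.pi fun _ : Fin m => Measure.pi fun _ : Fin n => N)
      (Measure.pi fun _ : Fin m × Fin n => N) := by
    refine ⟨by fun_prop, ?_⟩
    have := Measure.infinitePi_map_curry (ι := Fin m) (κ := Fin n) (fun _ _ => N)
    simpa only [Measure.infinitePi_eq_pi] using this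
  have h3 : HasLaw (fun (g : Fin m → Fin n → ℝ) j => WithLp.toLp 2 (g j))
      (matLaw (EuclideanSpace ℝ (Fin n)) (Fin m) (√n)⁻¹)
      (Measure.pi fun _ : Fin m => Measure.pi fun _ : Fin n => N) := by
    refine ⟨Measurable.aemeasurable (by fun_prop), ?_⟩
    have : ∀ _ : Fin m, SigmaFinite ((Measure.pi fun _ : Fin n => N).map (WithLp.toLp 2)) :=
      fun _ => by rw [← colLaw_euclideanSpace]; infer_instance
    rw [Measure.pi_map_pi (f := fun _ : Fin m => WithLp.toLp 2) (fun _ => by fun_prop), matLaw,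
      colLaw_euclideanSpace]
  exact h3.comp (h2.comp h1)

variable {σ : ℝ≥0} {ν : Ω → EuclideanSpace ℝ (Fin n)}

lemma IsGaussianNoise.hasLaw (h : IsGaussianNoise μ σ ν) :
    HasLaw ν ((Measure.pi fun _ : Fin n => gaussianReal 0 (σ ^ 2)).map (WithLp.toLp 2)) μ :=
  HasLaw.comp (Y := WithLp.toLp 2) ⟨by fun_prop, rfl⟩ (h.2.hasLaw_pi h.1)

lemma gaussianReal_ball_pos (v : ℝ≥0) {ε : ℝ} (hε : 0 < ε) :
    gaussianReal 0 v (Metric.ball 0 ε) ≠ 0 := by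
  by_cases hv : v = 0
  · simp [hv, hε]
  · intro h
    have := gaussianReal_absolutelyContinuous' 0 hv h
    simp [Real.volume_ball, hε.not_ge] at this

/-- The noise is small with positive probability. -/
lemma IsGaussianNoise.measure_ne_zero (h : IsGaussianNoise μ σ ν)
    {s : Set (EuclideanSpace ℝ (Fin n))} (hs : s ∈ nhds 0) (hsm : MeasurableSet s) :
    μ {ω | ν ω ∈ s} ≠ 0 := by
  have h1 : μ {ω | ν ω ∈ s} =
      (Measure.pi fun _ : Fin n => gaussianReal 0 (σ ^ 2)) (WithLp.toLp 2 ⁻¹' s) := by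
    rw [← Measure.map_apply (by fun_prop) hsm, ← h.hasLaw.map_eq,
      Measure.map_apply_of_aemeasurable h.hasLaw.aemeasurable hsm]
    rfl
  have h2 : WithLp.toLp 2 ⁻¹' s ∈ nhds (0 : Fin n → ℝ) :=
    (PiLp.continuous_toLp 2 fun _ : Fin n => ℝ).continuousAt.preimage_mem_nhds (by simpa using hs)
  obtain ⟨ε, hε, hball⟩ := Metric.mem_nhds_iff.1 h2
  rw [h1]
  refine fun h0 => ?_
  have h3 := measure_mono_null hball h0
  rw [ball_pi _ hε, Measure.pi_pi, Finset.prod_eq_zero_iff] at h3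
  obtain ⟨i, -, hi⟩ := h3
  exact gaussianReal_ball_pos _ hε hi

end Laws

/-! ### Recovery with high probability -/

lemma exp_neg_le_div_pow {β t : ℝ} {m a : ℕ} (hβ : 0 < β) (hβ1 : β < 1) (hm : 0 < m) (ha : 2 ≤ a)
    (h : a * Real.log (m / β) ≤ t) : Real.exp (-t) ≤ β ^ 2 / (m : ℝ) ^ a := by
  have hm' : (0 : ℝ) < m := by exact_mod_cast hm
  calc Real.exp (-t) ≤ Real.exp (-(a * Real.log (m / β))) := Real.exp_le_exp.2 (by linarith)
    _ = β ^ a / (m : ℝ) ^ a := by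
      rw [Real.exp_neg, Real.exp_nat_mul, Real.exp_log (by positivity), div_pow, inv_div]
    _ ≤ _ := by
      gcongr ?_ / _
      exact pow_le_pow_of_le_one hβ.le hβ1.le ha

/-- Since `k + L - 1 < m ^ (2 / 3)`, the logarithm in the assumption on `n` is comparable with
`log (m / β)`. -/
lemma log_div_le {β s : ℝ} {m : ℕ} (hβ : 0 < β) (hs : 1 ≤ s) (hsm : s ^ (3 / 2 : ℝ) < m) :
    Real.log (m / β) ≤ 3 * Real.log (m / (s * β ^ (1 / 3 : ℝ))) := by
  have hs0 : 0 < s := by linarith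
  have hm : (0 : ℝ) < m := (Real.rpow_pos_of_pos hs0 _).trans hsm
  have h1 := Real.log_lt_log (Real.rpow_pos_of_pos hs0 _) hsm
  rw [Real.log_rpow hs0] at h1
  have hβ3 : 0 < β ^ (1 / 3 : ℝ) := Real.rpow_pos_of_pos hβ _
  rw [Real.log_div hm.ne' hβ.ne', Real.log_div hm.ne' (by positivity),
    Real.log_mul hs0.ne' hβ3.ne', Real.log_rpow hβ]
  linarith

/-- Failure of an event `R` has small probability conditionally on an event `{Y ∈ T}` if for every
fixed value of `Y` in `T` it is implied by an event of small probability. -/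
lemma one_sub_le_cond_real {Ω α γ : Type*} [MeasurableSpace Ω] [MeasurableSpace α]
    [MeasurableSpace γ] {μ : Measure Ω} [IsProbabilityMeasure μ] {P : Measure α} {κ : Measure γ}
    [IsProbabilityMeasure P] [IsProbabilityMeasure κ] {X : Ω → α} {Y : Ω → γ}
    (hXY : HasLaw (fun ω => (X ω, Y ω)) (P.prod κ) μ) (hY : HasLaw Y κ μ)
    {B : Set (α × γ)} (hB : MeasurableSet B) {T : Set γ} (hT : MeasurableSet T)
    (hT0 : μ {ω | Y ω ∈ T} ≠ 0) {p : ℝ} (hp : ∀ y ∈ T, P.real {x | (x, y) ∈ B} ≤ p) (hp0 : 0 ≤ p)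
    {R : Set Ω} (hR : ∀ ω, Y ω ∈ T → (X ω, Y ω) ∉ B → ω ∈ R) :
    1 - p ≤ (cond μ {ω | Y ω ∈ T}).real R := by
  set F := {ω | Y ω ∈ T} with hF
  have hFnull : NullMeasurableSet F μ := hY.aemeasurable.nullMeasurableSet_preimage hT
  have hprob : IsProbabilityMeasure (cond μ F) := cond_isProbabilityMeasure hT0
  have hμF : μ F = κ T := by
    rw [← hY.map_eq, Measure.map_apply_of_aemeasurable hY.aemeasurable hT]; rfl
  have hbad : μ (Rᶜ ∩ F) ≤ ENNReal.ofReal p * μ F := by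
    have hsub : Rᶜ ∩ F ⊆ (fun ω => (X ω, Y ω)) ⁻¹' (B ∩ Set.univ ×ˢ T) := by
      rintro ω ⟨hω, hωF⟩
      exact ⟨by_contra fun h => hω (hR ω hωF h), Set.mem_univ _, hωF⟩
    have hm : MeasurableSet (B ∩ Set.univ ×ˢ T) := hB.inter (MeasurableSet.univ.prod hT)
    calc μ (Rᶜ ∩ F) ≤ _ := measure_mono hsub
      _ = (P.prod κ) (B ∩ Set.univ ×ˢ T) := by
        rw [← hXY.map_eq, Measure.map_apply_of_aemeasurable hXY.aemeasurable hm]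
      _ = ∫⁻ y, P ((fun x => (x, y)) ⁻¹' (B ∩ Set.univ ×ˢ T)) ∂κ := Measure.prod_apply_symm hm
      _ ≤ ∫⁻ y, T.indicator (fun _ => ENNReal.ofReal p) y ∂κ := by
        refine lintegral_mono fun y => ?_
        by_cases hy : y ∈ T
        · rw [Set.indicator_of_mem hy]
          refine (measure_mono fun x hx => hx.1 : _ ≤ P {x | (x, y) ∈ B}).trans ?_
          rw [← ofReal_measureReal]
          exact ENNReal.ofReal_le_ofReal (hp y hy)
        · rw [Set.indicator_of_notMem hy]
          refine le_of_eq (measure_mono_null (fun x hx => hy hx.2.2) measure_empty)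
      _ = ENNReal.ofReal p * κ T := lintegral_indicator_const hT _
      _ = _ := by rw [hμF]
  have hcond : (cond μ F) Rᶜ ≤ ENNReal.ofReal p := by
    rw [ProbabilityTheory.cond, Measure.smul_apply, Measure.restrict_apply₀' hFnull, smul_eq_mul]
    calc (μ F)⁻¹ * μ (Rᶜ ∩ F) ≤ (μ F)⁻¹ * (ENNReal.ofReal p * μ F) := by gcongr
      _ = ENNReal.ofReal p := by
        rw [mul_comm, mul_assoc, ENNReal.mul_inv_cancel hT0 (measure_ne_top _ _), mul_one]
  have h1 : (cond μ F).real Rᶜ ≤ p := ENNReal.toReal_le_of_le_ofReal hp0 hcond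
  have h2 : 1 ≤ (cond μ F).real R + (cond μ F).real Rᶜ := by
    have := measureReal_union_le (μ := cond μ F) R Rᶜ
    rwa [Set.union_compl_self, probReal_univ] at this
  linarith

/-- The recovery probability, in terms of the constants of the deterministic part. -/
theorem one_sub_sq_lt_cond_recovers {n m k L : ℕ} {δ θ c₀ C₄ C₅ β ε : ℝ} (hL : 1 ≤ L)
    (hk : 1 ≤ k) (hkn : k < n) (hnm : n < m) (hδ : 0 < δ) (hδ2 : δ ≤ 1 / 2) (hc₀ : 0 ≤ c₀)
    (hθ : 0 ≤ θ) (hθ1 : θ < 1) (hC₄ : 1 ≤ θ * (1 - δ) * C₄) (hC₅ : C₅ ≤ (1 - θ) * (1 - δ))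
    (hc₀' : 4 * c₀ * (1 + θ) < (1 - θ) * (1 - δ)) (hβ : 0 < β)
    (hkL : (k * L : ℕ) ≤ δ / 4 * n) (hkLn : k * L + 2 ≤ n)
    (hq : Real.exp (-(δ ^ 2 / 8 * n)) ≤ β ^ 2 / (m : ℝ) ^ (k * L + 5))
    (hp : Real.exp (-(c₀ ^ 2 / 2 * (n / k))) ≤ β ^ 2 / (m : ℝ) ^ 5)
    {x : Fin m → ℝ} (hx : {j | x j ≠ 0}.ncard ≤ k) (hεx : ∀ j, x j ≠ 0 → ε ≤ C₅ * |x j|)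
    {σ : ℝ≥0} {Ω : Type*} [MeasurableSpace Ω] {μ : Measure Ω} [IsProbabilityMeasure μ]
    {A : Ω → Matrix (Fin n) (Fin m) ℝ} {ν : Ω → EuclideanSpace ℝ (Fin n)}
    (hA : IsGaussianMatrix μ A) (hν : IsGaussianNoise μ σ ν)
    (hind : IndepFun (fun ω (p : Fin n × Fin m) => A ω p.1 p.2) ν μ) :
    1 - β ^ 2 < (cond μ {ω | ∀ j, x j ≠ 0 → C₄ * ‖ν ω‖ ≤ |x j|}).real
      {ω | Recovers (A ω) (measurements (A ω) x (ν ω)) k L ε x} := by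
  set T : Set (EuclideanSpace ℝ (Fin n)) := {v | ∀ j, x j ≠ 0 → C₄ * ‖v‖ ≤ |x j|} with hT
  have hTm : MeasurableSet T := by
    have : ∀ j, Measurable fun v : EuclideanSpace ℝ (Fin n) => C₄ * ‖v‖ ≤ |x j| := fun j =>
      measurableSet_setOfPred.1 (measurableSet_le (by fun_prop) measurable_const)
    exact measurableSet_setOfPred.2 (by fun_prop)
  have hTn : T ∈ nhds 0 := by
    refine Filter.eventually_all.2 fun j => ?_
    by_cases hj : x j = 0
    · exact .of_forall fun _ h => absurd hj h
    have hcont : Continuous fun v : EuclideanSpace ℝ (Fin n) => C₄ * ‖v‖ := by fun_prop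
    have := hcont.continuousAt.eventually_lt (x₀ := 0) (continuousAt_const (y := |x j|))
      (by simpa using hj)
    filter_upwards [this] with v hv _ using hv.le
  have hcol := hA.hasLaw_col
  have hnoise := hν.hasLaw
  have hindep : IndepFun (fun ω => col (A ω)) ν μ :=
    hind.comp (φ := fun (g : Fin n × Fin m → ℝ) j => WithLp.toLp 2 fun i => g (i, j))
      (ψ := id) (by fun_prop) measurable_id
  have hjoint := hindep.hasLaw_prod hcol hnoise
  have hprob : IsProbabilityMeasure
      ((Measure.pi fun _ : Fin n => gaussianReal 0 (σ ^ 2)).map (WithLp.toLp 2)) :=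
    Measure.isProbabilityMeasure_map (by fun_prop)
  have hB : MeasurableSet {z : (Fin m → EuclideanSpace ℝ (Fin n)) × EuclideanSpace ℝ (Fin n) |
      ¬ Good z.1 x (∑ j, x j • z.1 j + z.2) k L (1 - δ) c₀} :=
    measurableSet_setOfPred.2 (measurable_good measurable_fst (by fun_prop) x k L _ _).not
  have hmain := one_sub_le_cond_real hjoint hnoise hB hTm (hν.measure_ne_zero hTn hTm)
    (fun v _ => matLaw_not_good_le hδ hδ2 hc₀ hk hkn hnm hkL hkLn hq hp x v) (by positivity)
    (R := {ω | Recovers (A ω) (measurements (A ω) x (ν ω)) k L ε x}) ?_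
  · refine lt_of_lt_of_le ?_ hmain
    have hm3 : (3 : ℝ) ≤ m := by exact_mod_cast (by omega : 3 ≤ m)
    have h27 : (27 : ℝ) ≤ (m : ℝ) ^ 3 := by
      calc (27 : ℝ) = 3 ^ 3 := by norm_num
        _ ≤ _ := by gcongr
    have : 5 * (β ^ 2 / (m : ℝ) ^ 3) < β ^ 2 := by
      rw [mul_div_assoc', div_lt_iff₀ (by positivity)]
      have h1 : 0 < β ^ 2 := by positivity
      have h2 : β ^ 2 * 27 ≤ β ^ 2 * (m : ℝ) ^ 3 := by gcongr
      linarith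
    linarith
  · intro ω hω hgood
    have hG : Good (col (A ω)) x (measurements (A ω) x (ν ω)) k L (1 - δ) c₀ := by
      rw [measurements_eq]
      exact not_not.1 hgood
    refine hG.recovers hL hk (by omega) ?_ (by linarith) hθ hθ1 hC₄ hC₅ hc₀ hc₀' hεx hω
    rwa [Set.ncard_eq_toFinset_card', Set.toFinset_ofPred] at hx

end AOLS

theorem corollary3 (L : ℕ) (hL : 1 ≤ L) (C₄ : ℝ) (hC₄ : 1 < C₄) :
    ∃ C₁ C₂ C₃ C₅ : ℝ, 0 < C₁ ∧ 0 < C₂ ∧ 0 < C₃ ∧ 0 < C₅ ∧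
      ∀ (β : ℝ) (n m k : ℕ), 0 < β → β < 1 → 1 ≤ k → k < n → n < m → L ≤ n / k →
        ((k : ℝ) + L - 1) ^ (3 / 2 : ℝ) < m →
        max (6 / C₁ * k * Real.log (m / (((k : ℝ) + L - 1) * β ^ (1 / 3 : ℝ))))
          ((C₂ * k + Real.log (8 / β ^ 2)) / C₃) ≤ n →
      ∀ (x : Fin m → ℝ), {j | x j ≠ 0}.ncard ≤ k →
      ∀ (ε : ℝ), 0 ≤ ε → (∀ j, x j ≠ 0 → ε ≤ C₅ * |x j|) →
      ∀ (σ : ℝ≥0) (Ω : Type*) [MeasurableSpace Ω] (μ : Measure Ω) [IsProbabilityMeasure μ]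
        (A : Ω → Matrix (Fin n) (Fin m) ℝ) (ν : Ω → EuclideanSpace ℝ (Fin n)),
        AOLS.IsGaussianMatrix μ A → AOLS.IsGaussianNoise μ σ ν →
        IndepFun (fun ω (p : Fin n × Fin m) => A ω p.1 p.2) ν μ →
        1 - β ^ 2 <
          (cond μ {ω | ∀ j, x j ≠ 0 → C₄ * ‖ν ω‖ ≤ |x j|}).real
            {ω | AOLS.Recovers (A ω) (AOLS.measurements (A ω) x (ν ω)) k L ε x} := by
  -- `θ` bounds the ratio of the noise and of the projection of the missing part of the signal;
  -- it is smaller than one because `δ` is so small that `(1 - δ) * C₄ > 1`.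
  obtain ⟨δ, hδ⟩ : ∃ δ, δ = (1 - 1 / C₄) / 2 := ⟨_, rfl⟩
  obtain ⟨θ, hθ⟩ : ∃ θ, θ = 2 / (C₄ + 1) := ⟨_, rfl⟩
  have hC0 : 0 < C₄ := by linarith
  have hinv : 1 / C₄ < 1 := by rw [div_lt_one hC0]; exact hC₄
  have hinv0 : 0 < 1 / C₄ := by positivity
  have hδ0 : 0 < δ := by rw [hδ]; linarith
  have hδ2 : δ ≤ 1 / 2 := by rw [hδ]; linarith
  have hθ0 : 0 ≤ θ := by rw [hθ]; positivity
  have hθ1 : θ < 1 := by rw [hθ, div_lt_one (by linarith)]; linarith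
  have hθκ : 1 ≤ θ * (1 - δ) * C₄ := by
    apply le_of_eq
    rw [hδ, hθ]
    field_simp
    ring
  obtain ⟨C₅, hC₅⟩ : ∃ C₅, C₅ = (1 - θ) * (1 - δ) := ⟨_, rfl⟩
  have hC₅0 : 0 < C₅ := by rw [hC₅]; exact mul_pos (by linarith) (by linarith)
  obtain ⟨c₀, hc₀⟩ : ∃ c₀, c₀ = C₅ / 16 := ⟨_, rfl⟩
  have hc₀0 : 0 < c₀ := by rw [hc₀]; positivity
  -- The sample size is at least `K * k * log (m / β)`; the four summands of `K` serve the four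
  -- conditions `hq`, `hp`, `hkL` and `hkLn` below.
  obtain ⟨K, hK⟩ : ∃ K : ℝ, K = (L + 5) * 8 / δ ^ 2 + 10 / c₀ ^ 2 + 4 * L / δ + (L + 2) :=
    ⟨_, rfl⟩
  have hL0 : (0 : ℝ) ≤ L := Nat.cast_nonneg L
  have hK1 : (L + 5) * 8 / δ ^ 2 ≤ K := by
    have : 0 ≤ 10 / c₀ ^ 2 + 4 * L / δ + (L + 2) := by positivity
    linarith
  have hK2 : 10 / c₀ ^ 2 ≤ K := by
    have : 0 ≤ (L + 5) * 8 / δ ^ 2 + 4 * L / δ + (L + 2) := by positivity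
    linarith
  have hK3 : 4 * L / δ ≤ K := by
    have : 0 ≤ (L + 5) * 8 / δ ^ 2 + 10 / c₀ ^ 2 + (L + 2) := by positivity
    linarith
  have hK4 : L + 2 ≤ K := by
    have : 0 ≤ (L + 5) * 8 / δ ^ 2 + 10 / c₀ ^ 2 + 4 * L / δ := by positivity
    linarith
  have hK0 : 0 < K := by linarith
  refine ⟨2 / K, 1, 1, C₅, by positivity, one_pos, one_pos, hC₅0, ?_⟩
  intro β n m k hβ hβ1 hk hkn hnm _ hsm hmax x hx ε _ hεx σ Ω _ μ _ A ν hA hν hind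
  have hk1 : (1 : ℝ) ≤ k := by exact_mod_cast hk
  have hL1 : (1 : ℝ) ≤ L := by exact_mod_cast hL
  have hm3 : (3 : ℝ) ≤ m := by exact_mod_cast (by omega : 3 ≤ m)
  obtain ⟨ℓ, hℓ⟩ : ∃ ℓ, ℓ = Real.log (m / β) := ⟨_, rfl⟩
  have hℓ1 : 1 ≤ ℓ := by
    rw [hℓ, Real.le_log_iff_exp_le (by positivity)]
    calc Real.exp 1 ≤ 3 := Real.exp_one_lt_three.le
      _ ≤ m := hm3
      _ ≤ m / β := by rw [le_div_iff₀ hβ]; nlinarith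
  have hn : K * k * ℓ ≤ n := by
    have h1 := hℓ.trans_le <| AOLS.log_div_le hβ (by linarith : (1 : ℝ) ≤ k + L - 1) hsm
    have h2 := (le_max_left _ _).trans hmax
    have h3 : 6 / (2 / K) = 3 * K := by field_simp; norm_num
    rw [h3] at h2
    calc K * k * ℓ ≤ K * k * (3 * Real.log (m / (((k : ℝ) + L - 1) * β ^ (1 / 3 : ℝ)))) := by gcongr
      _ = _ := by ring
      _ ≤ n := h2
  have hnK : K * k ≤ n := le_trans (le_mul_of_one_le_right (by positivity) hℓ1) hn
  have hkL : ((k * L : ℕ) : ℝ) ≤ δ / 4 * n := by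
    calc ((k * L : ℕ) : ℝ) = δ / 4 * (4 * L / δ * k) := by push_cast; field_simp
      _ ≤ δ / 4 * (K * k) := by gcongr
      _ ≤ _ := by gcongr
  have hkLn : k * L + 2 ≤ n := by
    have h1 : (L + 2) * (k : ℝ) ≤ K * k := by gcongr
    have : (k * L + 2 : ℝ) ≤ n := by nlinarith
    exact_mod_cast this
  have hq : Real.exp (-(δ ^ 2 / 8 * n)) ≤ β ^ 2 / (m : ℝ) ^ (k * L + 5) := by
    refine AOLS.exp_neg_le_div_pow hβ hβ1 (by omega) (by omega) ?_
    rw [← hℓ]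
    calc ((k * L + 5 : ℕ) : ℝ) * ℓ ≤ ((L + 5) * k) * ℓ := by
          gcongr; push_cast; nlinarith
      _ = δ ^ 2 / 8 * ((L + 5) * 8 / δ ^ 2 * k * ℓ) := by field_simp
      _ ≤ δ ^ 2 / 8 * (K * k * ℓ) := by gcongr
      _ ≤ _ := by gcongr
  have hp : Real.exp (-(c₀ ^ 2 / 2 * (n / k))) ≤ β ^ 2 / (m : ℝ) ^ 5 := by
    refine AOLS.exp_neg_le_div_pow hβ hβ1 (by omega) (by omega) ?_
    rw [← hℓ]
    calc ((5 : ℕ) : ℝ) * ℓ = c₀ ^ 2 / 2 * ((10 / c₀ ^ 2 * k * ℓ) / k) := by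
          field_simp; norm_num
      _ ≤ c₀ ^ 2 / 2 * ((K * k * ℓ) / k) := by gcongr
      _ ≤ _ := by gcongr
  refine AOLS.one_sub_sq_lt_cond_recovers hL hk hkn hnm hδ0 hδ2 hc₀0.le hθ0 hθ1 hθκ hC₅.le ?_ hβ
    hkL hkLn hq hp hx hεx hA hν hind
  rw [← hC₅, hc₀]
  have : C₅ * θ < C₅ * 1 := by gcongr
  linarith
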